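/- Let $n\in\mathbb{N}$. For each $k\in\mathbb{N}^+$ let $0\le r_{k_1}\le r_{k_2}\le\cdots\le r_{k_n}\le 1$ be real numbers and let $h_{n,k}\in\mathbb{R}[x]$ be the polynomial determined by the identity of formal power series $$\sum_{m\ge 0}\ \prod_{i=1}^{n}(m+r_{k_i})\,x^m=\frac{h_{n,k}(x)}{(1-x)^{n+1}} .$$ Let $c_k\ge 0$ for $k\ge1$ and let $p=\sum_{k\ge1}c_kh_{n,k}$ be a polynomial of degree $n$ (the sum is finite or, more generally, converges coefficientwise). Let $(a,b)$ be the symmetric decomposition of $p$ with respect to $n$, i.e. the unique pair of polynomials with $p=a+xb$, $\deg a\le n$, $\deg b\le n-1$ (so $b=0$ if $n=0$), $a(x)=x^na(1/x)$ and $b(x)=x^{n-1}b(1/x)$. Put $\mathcal{I}_n(p)(x)=x^np(1/x)$. For nonzero real-rooted $f,g\in\mathbb{R}[x]$, with zeros (listed with multiplicity) $\cdots\le r_2\le r_1$ of $f$ and $\cdots\le s_2\le s_1$ of $g$, write $g\preceq f$ if either $\deg f=\deg g+1=d$ and $r_d\le s_{d-1}\le\cdots\le r_2\le s_1\le r_1$,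 or $\deg f=\deg g=d$ and $s_d\le r_d\le\cdots\le s_1\le r_1$. Write $g\ll f$ if $g\preceq f$ and the leading coefficients of $f,g$ have the same sign, or $f\preceq g$ and the leading coefficients have opposite signs; moreover, by convention, $0\ll f$ and $f\ll 0$ for every real-rooted $f$ (and for $f=0$). If $0\le r_{k_i}+r_{\ell_{n-i+1}}\le 1$ for all $k,\ell\in\mathbb{N}^+$ and all $1\le i\le n$, then: 1. $\mathcal{I}_n(p)\ll p$; 2. $b\ll a$; 3. $p=\sum_{j=0}^n p_jx^j$ is alternatingly increasing, i.e. $0\le p_0\le p_n\le p_1\le p_{n-1}\le\cdots\le p_{\lfloor (n+1)/2\rfloor}$. -/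

import Mathlib

open Polynomial

/-- `(m ↦ i(m))` has the generating function `∑ₘ i(m) xᵐ = h(x) / (1 - x)^(n+1)`, where `deg i = n`:
`h` is the `h`-polynomial of `i`. The identity is one of formal power series. -/
def IsHPolynomial (n : ℕ) (i h : ℝ[X]) : Prop :=
  i.degree = n ∧
    (PowerSeries.mk fun m : ℕ => i.eval (m : ℝ)) * (1 - PowerSeries.X) ^ (n + 1)
      = (h : PowerSeries ℝ)

/-- A polynomial of degree `n` has exactly one `h`-polynomial. -/
theorem IsHPolynomial.existsUnique (n : ℕ) (i : ℝ[X]) (hi : i.degree = n) :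
    ∃! h, IsHPolynomial n i h := by
  have key : ∀ (n : ℕ) (i : ℝ[X]), i.natDegree ≤ n → ∃ h : ℝ[X],
      (PowerSeries.mk fun m : ℕ => i.eval (m : ℝ)) * (1 - PowerSeries.X) ^ (n + 1)
        = (h : PowerSeries ℝ) := by
    have step : ∀ i : ℝ[X], (PowerSeries.mk fun m : ℕ => i.eval (m : ℝ)) * (1 - PowerSeries.X)
        = PowerSeries.C (i.eval 0)
          + PowerSeries.X * PowerSeries.mk fun m : ℕ => (taylor 1 i - i).eval (m : ℝ) := by
      intro i
      ext m
      rw [mul_sub, mul_one]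
      cases m with
      | zero => simp
      | succ m =>
        rw [mul_comm _ PowerSeries.X]
        simp [PowerSeries.coeff_succ_X_mul, taylor_eval]
    intro n
    induction n with
    | zero =>
      intro i hi
      obtain ⟨a, rfl⟩ : ∃ a, i = C a := ⟨_, eq_C_of_natDegree_le_zero hi⟩
      refine ⟨C a, ?_⟩
      rw [zero_add, pow_one, step]
      ext m
      cases m <;> simp [PowerSeries.coeff_succ_X_mul, PowerSeries.coeff_C]
    | succ n ih =>
      intro i hi
      obtain ⟨h, hh⟩ := ih (taylor 1 i - i) (by
        by_cases h0 : i = 0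
        · simp [h0]
        have hlt : (taylor 1 i - i).degree < (taylor 1 i).degree := by
          apply degree_sub_lt_left
          · exact degree_taylor _ _
          · rw [Ne, ← degree_eq_bot, degree_taylor, degree_eq_bot]; exact h0
          · exact leadingCoeff_taylor _ _
        rw [degree_taylor] at hlt
        have h2 : (taylor 1 i - i).degree < ((n + 1 : ℕ) : WithBot ℕ) :=
          hlt.trans_le (natDegree_le_iff_degree_le.1 hi)
        rcases eq_or_ne (taylor 1 i - i) 0 with h3 | h3
        · simp [h3]
        · exact Nat.lt_succ_iff.1 ((natDegree_lt_iff_degree_lt h3).2 h2))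
      refine ⟨C (i.eval 0) * (1 - X) ^ (n + 1) + X * h, ?_⟩
      rw [pow_succ', ← mul_assoc, step, add_mul, mul_assoc, hh]
      simp
  obtain ⟨h, hh⟩ := key n i (natDegree_le_iff_degree_le.2 hi.le)
  refine ⟨h, ⟨hi, hh⟩, fun h' hh' => ?_⟩
  exact Polynomial.coe_injective ℝ (hh'.2.symm.trans hh)

/-- `g` interlaces `f`: both are real-rooted, `deg f = deg g + 1 = n + 1`, and their zeros satisfy
`r n ≤ s (n-1) ≤ r (n-1) ≤ ⋯ ≤ s 0 ≤ r 0` (`r` for `f`, `s` for `g`, with multiplicity). -/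
def Interlaces (g f : ℝ[X]) : Prop :=
  ∃ (n : ℕ) (r : Fin (n + 1) → ℝ) (s : Fin n → ℝ) (α β : ℝ), α ≠ 0 ∧ β ≠ 0 ∧
    f = C α * ∏ i, (X - C (r i)) ∧ g = C β * ∏ i, (X - C (s i)) ∧
    ∀ i : Fin n, r i.succ ≤ s i ∧ s i ≤ r i.castSucc

/-- `g` alternates left of `f`: both are real-rooted, `deg f = deg g = n`, and their zeros satisfy
`s (n-1) ≤ r (n-1) ≤ ⋯ ≤ s 0 ≤ r 0` (`r` for `f`, `s` for `g`, with multiplicity). -/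
def AlternatesLeft (g f : ℝ[X]) : Prop :=
  ∃ (n : ℕ) (r s : Fin n → ℝ) (α β : ℝ), α ≠ 0 ∧ β ≠ 0 ∧
    f = C α * ∏ i, (X - C (r i)) ∧ g = C β * ∏ i, (X - C (s i)) ∧
    (∀ i : Fin n, s i ≤ r i) ∧ ∀ i j : Fin n, i < j → r j ≤ s i

/-- `g ⪯ f`. -/
def Preceq (g f : ℝ[X]) : Prop := Interlaces g f ∨ AlternatesLeft g f

/-- `g ≪ f`: `g ⪯ f` with leading coefficients of the same sign, or `f ⪯ g` with leading
coefficients of opposite signs; by the usual convention (the one under which `g ≪ f` means that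
`f + i g` is stable or zero) also `0 ≪ f` and `g ≪ 0` for real-rooted `f`, `g`. -/
def LL (g f : ℝ[X]) : Prop :=
  (Preceq g f ∧ 0 < g.leadingCoeff * f.leadingCoeff) ∨
  (Preceq f g ∧ g.leadingCoeff * f.leadingCoeff < 0) ∨
  (g = 0 ∧ f.Splits) ∨ (f = 0 ∧ g.Splits)

/-- `(a, b)` is the symmetric decomposition of `p` with respect to `n`: `p = a + x b` with
`a = xⁿ a(1/x)` and `b = xⁿ⁻¹ b(1/x)`, `deg a ≤ n`, `deg b ≤ n - 1` (so `b = 0` if `n = 0`).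
For `deg q ≤ m`, `reflect m q` is `xᵐ q(1/x)`. -/
structure IsSymmDecomp (n : ℕ) (p a b : ℝ[X]) : Prop where
  eq : p = a + X * b
  deg_a : a.degree ≤ n
  deg_b : b.degree < n
  symm_a : a.reflect n = a
  symm_b : b.reflect (n - 1) = b

/-- Every polynomial of degree at most `n` has exactly one symmetric decomposition. -/
theorem IsSymmDecomp.existsUnique (n : ℕ) (p : ℝ[X]) (hp : p.degree ≤ n) :
    ∃! ab : ℝ[X] × ℝ[X], IsSymmDecomp n p ab.1 ab.2 := by
  have hX1 : (X - C 1 : ℝ[X]) ≠ 0 := X_sub_C_ne_zero 1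
  have rX : reflect 1 (X : ℝ[X]) = 1 := by simp 
  have r1 : reflect 1 (1 : ℝ[X]) = X := by simp
  rcases Nat.eq_zero_or_pos n with rfl | hn
  · obtain ⟨u, rfl⟩ : ∃ u, p = C u := ⟨_, eq_C_of_degree_le_zero hp⟩
    refine ⟨(C u, 0), ⟨by simp, hp, by simp, by simp, by simp⟩, ?_⟩
    rintro ⟨a, b⟩ ⟨h1, -, h2, -, -⟩
    have hb : b = 0 := by
      by_contra hb
      exact absurd h2 (not_lt.2 (zero_le_degree_iff.2 hb))
    subst hb
    simp at h1
    simp [h1]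
  obtain ⟨m, rfl⟩ : ∃ m, n = 1 + m := ⟨n - 1, by omega⟩
  have refl2 : ∀ (u v : ℝ[X]), u.natDegree ≤ 1 → v.natDegree ≤ m →
      reflect (1 + m) (u * v) = reflect 1 u * reflect m v := fun u v hu hv =>
    reflect_mul u v hu hv
  have degm : ∀ b : ℝ[X], b.degree < ((1 + m : ℕ) : WithBot ℕ) → b.natDegree ≤ m := by
    intro b hb
    rcases eq_or_ne b 0 with h3 | h3
    · simp [h3]
    · have := (natDegree_lt_iff_degree_lt h3).2 hb
      omega
  have hdvd : (X - C 1) ∣ p - reflect (1 + m) p := by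
    rw [dvd_iff_isRoot, IsRoot, eval_sub, sub_eq_zero]
    let _ : Invertible (1 : ℝ) := invertibleOne
    have := eval₂_reflect_mul_pow (RingHom.id ℝ) 1 (1 + m) p (natDegree_le_iff_degree_le.2 hp)
    simpa [← eval₂_eq_eval_map, eval₂_id] using this.symm
  obtain ⟨b, hb⟩ := hdvd
  have hrefl : reflect (1 + m) (reflect (1 + m) p) = p := by
    ext k; simp
  have hdeg : b.natDegree ≤ m := by
    rcases eq_or_ne b 0 with h3 | h3
    · simp [h3]
    have h4 : ((X - C 1) * b).natDegree ≤ 1 + m := by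
      rw [← hb]
      refine (natDegree_sub_le _ _).trans (max_le (natDegree_le_iff_degree_le.2 hp) ?_)
      rw [natDegree_le_iff_coeff_eq_zero]
      intro k hk
      rw [coeff_reflect, revAt_eq_self_of_lt hk]
      exact coeff_eq_zero_of_degree_lt (hp.trans_lt (by exact_mod_cast hk))
    rw [natDegree_mul hX1 h3, natDegree_X_sub_C] at h4
    omega
  have hbs : reflect m b = b := by
    have h5 := congrArg (reflect (1 + m)) hb
    rw [refl2 _ _ (natDegree_X_sub_C_le 1) hdeg, reflect_sub, hrefl, reflect_sub, rX, C_1, r1] at h5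
    apply mul_left_cancel₀ hX1
    rw [← hb]
    rw [C_1]
    linear_combination h5
  have hXb : reflect (1 + m) (X * b) = b := by
    rw [refl2 _ _ natDegree_X_le hdeg, rX, hbs, one_mul]
  refine ⟨(p - X * b, b), ⟨by ring, ?_, ?_, ?_, by simpa using hbs⟩, ?_⟩
  · refine natDegree_le_iff_degree_le.1 ((natDegree_sub_le _ _).trans
      (max_le (natDegree_le_iff_degree_le.2 hp) ?_))
    exact natDegree_mul_le.trans (Nat.add_le_add natDegree_X_le hdeg)
  · exact (natDegree_le_iff_degree_le.1 hdeg).trans_lt (by exact_mod_cast (by omega : m < 1 + m))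
  · simp only [reflect_sub, hXb]
    rw [C_1] at hb
    linear_combination -hb
  · rintro ⟨a', b'⟩ ⟨h1, h2, h3, h4, h5⟩
    simp only [Nat.add_sub_cancel_left] at h1 h2 h3 h4 h5
    have h6 : reflect (1 + m) p = a' + b' := by
      rw [h1, reflect_add, h4, refl2 _ _ natDegree_X_le (degm _ h3), rX, h5, one_mul]
    have h7 : b' = b := by
      apply mul_left_cancel₀ hX1
      rw [← hb, h6, C_1]
      linear_combination -h1
    subst h7
    ext1
    · simp only; linear_combination -h1
    · rfl

/-- `p = ∑_{k ≤ n} p_k x^k` is alternatingly increasing: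
`0 ≤ p_0 ≤ p_n ≤ p_1 ≤ p_{n-1} ≤ ⋯ ≤ p_{⌊(n+1)/2⌋}`. -/
def AlternatinglyIncreasing (n : ℕ) (p : ℝ[X]) : Prop :=
  p.degree ≤ n ∧ 0 ≤ p.coeff 0 ∧
  (∀ i, 2 * i + 1 ≤ n → p.coeff i ≤ p.coeff (n - i)) ∧
  (∀ i, 2 * i + 2 ≤ n → p.coeff (n - i) ≤ p.coeff (i + 1))

/-! Write `E n j` for `eulerRefined n j`. Since `m + r = (1 - r) m + r (m + 1)`, each `h k` is a
nonnegative combination of the `E n j` whose weights are the coefficients of `failurePoly`. Hence `p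
= ∑ P j * E n j` with `P ≥ 0`. Reflection sends `E n j` to `E n (n - j)`, so it reverses the
weights. The condition `r k i + r l i.rev ≤ 1` compares success probabilities factor by factor, and
yields the likelihood ratio inequality `P k * P (n - j) ≤ P j * P (n - k)` for `k ≤ j`
(`likelihoodLE_failurePoly`, `exists_eq_sum_eulerRefined`).

At a point `z` of the upper half-plane the arguments of `E n 0, …, E n n` increase within a window
of length `arg z`; the recurrence preserves this (`ArgChain.succ`). So nonnegative combinations do
not vanish at `z`, and a likelihood ratio inequality between weights `U`, `V` becomes a sign of `Im
(f(z) conj g(z))`. Hermite–Biehler (`LL_of_im_mul_conj_nonneg`) turns that sign into `g ≪ f`, which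
is claim 1.

For claim 2 the recurrence gives `a` and `b` explicitly in terms of the `E (n - 1) k`, with partial
sums of `P` as weights, and the same method applies (`LL_of_cumulative`). Claim 3 is proved
independently of the zeros: `E n j` is alternatingly increasing for `j ≥ n / 2`, and `P` favours
these indices. -/

/-! ### Refined Eulerian polynomials: generating function and reflection -/

/-- The `h`-polynomial of `m ↦ m ^ j * (m + 1) ^ (n - j)` for `j ≤ n`: a refined Eulerian
polynomial. -/
noncomputable def eulerRefined : ℕ → ℕ → ℝ[X]
  | 0, _ => 1
  | n + 1, j => X * ∑ k ∈ Finset.range j, eulerRefined n k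
      + ∑ k ∈ Finset.Ico j (n + 1), eulerRefined n k

theorem eulerRefined_zero (j : ℕ) : eulerRefined 0 j = 1 := by rw [eulerRefined]

theorem eulerRefined_succ (n j : ℕ) :
    eulerRefined (n + 1) j = X * ∑ k ∈ Finset.range j, eulerRefined n k
      + ∑ k ∈ Finset.Ico j (n + 1), eulerRefined n k := by rw [eulerRefined]

/-- Mirrors `m ^ (j+1) (m+1) ^ (n-j) = m ^ j (m+1) ^ (n+1-j) - m ^ j (m+1) ^ (n-j)`; the subtracted
term has degree only `n`, whence the factor `1 - X`. -/
theorem eulerRefined_succ_succ {n j : ℕ} (hj : j ≤ n) :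
    eulerRefined (n + 1) (j + 1)
      = eulerRefined (n + 1) j + (X - 1) * eulerRefined n j := by
  rw [eulerRefined_succ, eulerRefined_succ, Finset.sum_range_succ,
    Finset.sum_eq_sum_Ico_succ_bot (Nat.lt_succ_of_le hj)]
  ring

theorem natDegree_eulerRefined_le (n : ℕ) : ∀ j, (eulerRefined n j).natDegree ≤ n := by
  induction n with
  | zero => intro j; simp [eulerRefined_zero]
  | succ n ih =>
    intro j
    rw [eulerRefined_succ]
    refine natDegree_add_le_of_degree_le ?_ ?_
    · rw [add_comm]
      exact natDegree_mul_le_of_le natDegree_X_le (natDegree_sum_le_of_forall_le _ _ fun k _ => ih k)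
    · exact natDegree_sum_le_of_forall_le _ _ fun k _ => (ih k).trans n.le_succ

theorem eulerRefined_genFun (n : ℕ) : ∀ j ≤ n,
    (PowerSeries.mk fun m : ℕ => (m : ℝ) ^ j * ((m : ℝ) + 1) ^ (n - j))
      * (1 - PowerSeries.X) ^ (n + 1) = (eulerRefined n j : PowerSeries ℝ) := by
  have hmul : ∀ i : ℕ → ℝ, PowerSeries.mk i * (1 - PowerSeries.X)
      = PowerSeries.mk fun m => i m - (if m = 0 then 0 else i (m - 1)) := by
    intro i
    ext m
    rw [mul_sub, mul_one]
    cases m with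
    | zero => simp
    | succ m => simp [PowerSeries.coeff_succ_mul_X]
  induction n with
  | zero =>
    intro j hj
    obtain rfl : j = 0 := by omega
    simp only [pow_zero, mul_one, zero_add, pow_one, Nat.sub_self, eulerRefined_zero, hmul]
    ext m
    cases m <;> simp [PowerSeries.coeff_one]
  | succ n ih =>
    intro j
    induction j with
    | zero =>
      intro _
      rw [pow_succ', ← mul_assoc, hmul, eulerRefined_succ]
      -- Multiplying by `1 - X` takes backward differences, and `(m+1) ^ (n+1) - m ^ (n+1)` is the
      -- geometric sum of the `m ^ k (m+1) ^ (n-k)`.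
      have : (PowerSeries.mk fun m : ℕ => (m : ℝ) ^ 0 * ((m : ℝ) + 1) ^ (n + 1 - 0)
            - if m = 0 then 0 else ((m - 1 : ℕ) : ℝ) ^ 0 * (((m - 1 : ℕ) : ℝ) + 1) ^ (n + 1 - 0))
          = ∑ k ∈ Finset.range (n + 1),
            PowerSeries.mk fun m : ℕ => (m : ℝ) ^ k * ((m : ℝ) + 1) ^ (n - k) := by
        ext m
        have h1 := (Commute.all (m : ℝ) ((m : ℝ) + 1)).geom_sum₂_mul (n + 1)
        simp only [map_sum, PowerSeries.coeff_mk, Nat.add_sub_cancel] at h1 ⊢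
        cases m with
        | zero => simp
        | succ m => push_cast at h1 ⊢; simp; linarith
      rw [this, Finset.sum_mul, Finset.sum_congr rfl fun k hk =>
        ih k (Nat.lt_succ_iff.1 (Finset.mem_range.1 hk))]
      rw [Finset.range_zero, Finset.sum_empty, mul_zero, zero_add, Finset.range_eq_Ico]
      exact (map_sum (coeToPowerSeries.ringHom (R := ℝ)) _ _).symm
    | succ j ihj =>
      intro hj
      have hj' : j ≤ n := by omega
      rw [eulerRefined_succ_succ hj', coe_add, coe_mul, ← ihj (by omega), ← ih j hj']
      have : (PowerSeries.mk fun m : ℕ => (m : ℝ) ^ (j + 1) * ((m : ℝ) + 1) ^ (n + 1 - (j + 1)))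
          = (PowerSeries.mk fun m : ℕ => (m : ℝ) ^ j * ((m : ℝ) + 1) ^ (n + 1 - j))
            - PowerSeries.mk fun m : ℕ => (m : ℝ) ^ j * ((m : ℝ) + 1) ^ (n - j) := by
        ext m
        have e : n + 1 - j = n - j + 1 := by omega
        simp only [map_sub, PowerSeries.coeff_mk, Nat.add_sub_add_right, e]
        ring
      rw [this]
      simp only [coe_sub, coe_X, coe_one]
      ring

theorem reflect_sum {ι : Type*} (N : ℕ) (s : Finset ι) (f : ι → ℝ[X]) :
    (∑ i ∈ s, f i).reflect N = ∑ i ∈ s, (f i).reflect N := by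
  ext k
  simp [coeff_reflect]

theorem reflect_reflect (N : ℕ) (f : ℝ[X]) : (f.reflect N).reflect N = f := by
  ext k
  simp

theorem natDegree_reflect_le' {N : ℕ} {f : ℝ[X]} (hf : f.natDegree ≤ N) :
    (f.reflect N).natDegree ≤ N := by
  rw [natDegree_le_iff_coeff_eq_zero]
  intro k hk
  rw [coeff_reflect, revAt_eq_self_of_lt hk]
  exact coeff_eq_zero_of_natDegree_lt (hf.trans_lt hk)

theorem reflect_succ_X_mul {n : ℕ} {f : ℝ[X]} (hf : f.natDegree ≤ n) :
    (X * f).reflect (n + 1) = f.reflect n := by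
  rw [add_comm, reflect_mul X f natDegree_X_le hf]
  simp

theorem reflect_succ {n : ℕ} {f : ℝ[X]} (hf : f.natDegree ≤ n) :
    f.reflect (n + 1) = X * f.reflect n := by
  have := reflect_mul (1 : ℝ[X]) f (F := 1) (G := n) (by simp) hf
  rw [one_mul, add_comm] at this
  rw [this]
  simp

theorem sum_Ico_reflect' (f : ℕ → ℝ[X]) {n j l : ℕ} (hl : l ≤ n + 1) :
    ∑ k ∈ Finset.Ico j l, f (n - k) = ∑ k ∈ Finset.Ico (n + 1 - l) (n + 1 - j), f k :=
  Finset.sum_Ico_reflect f j hl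

/-- Reflection exchanges the two sums of the recurrence, moving the factor `X` from one to the
other. -/
theorem reflect_eulerRefined (n : ℕ) : ∀ j ≤ n,
    (eulerRefined n j).reflect n = eulerRefined n (n - j) := by
  induction n with
  | zero => intro j _; simp [eulerRefined_zero]
  | succ n ih =>
    intro j hj
    have hdeg : ∀ s : Finset ℕ, (∑ k ∈ s, eulerRefined n k).natDegree ≤ n := fun s =>
      natDegree_sum_le_of_forall_le _ _ fun k _ => natDegree_eulerRefined_le n k
    rw [eulerRefined_succ, eulerRefined_succ, reflect_add, reflect_succ_X_mul (hdeg _),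
      reflect_succ (hdeg _), reflect_sum, reflect_sum, Finset.range_eq_Ico,
      Finset.sum_congr rfl (fun k hk => ih k (by simp at hk; omega)),
      Finset.sum_congr rfl (fun k hk => ih k (by simp at hk; omega)),
      sum_Ico_reflect' _ hj, sum_Ico_reflect' _ le_rfl]
    simp [add_comm]

theorem eval_one_eulerRefined_pos (n : ℕ) : ∀ j ≤ n, 0 < (eulerRefined n j).eval 1 := by
  induction n with
  | zero => intro j _; simp [eulerRefined_zero]
  | succ n ih =>
    intro j hj
    rw [eulerRefined_succ, eval_add, eval_mul, eval_X, one_mul, ← eval_add,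
      Finset.sum_range_add_sum_Ico _ hj, eval_finsetSum]
    exact Finset.sum_pos (fun k hk => ih k (Nat.lt_succ_iff.1 (Finset.mem_range.1 hk))) (by simp)

/-! ### Arguments of the values in the upper half-plane -/

open ComplexConjugate in
theorem im_sum_mul_conj_sum_nonneg {ι κ : Type*} {s : Finset ι} {t : Finset κ} {f : ι → ℂ}
    {g : κ → ℂ} (h : ∀ i ∈ s, ∀ j ∈ t, 0 ≤ (f i * conj (g j)).im) :
    0 ≤ ((∑ i ∈ s, f i) * conj (∑ j ∈ t, g j)).im := by
  rw [map_sum, Finset.sum_mul_sum, Complex.im_sum]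
  refine Finset.sum_nonneg fun i hi => ?_
  rw [Complex.im_sum]
  exact Finset.sum_nonneg fun j hj => h i hi j hj

theorem im_mul_mul_conj_self (z w : ℂ) :
    (z * w * (starRingEnd ℂ) w).im = z.im * Complex.normSq w := by
  rw [mul_assoc, Complex.mul_conj, Complex.im_mul_ofReal]

/-- The complex numbers `f 0, …, f n` are nonzero and their arguments increase weakly within a
window of the length `arg z`, where `z` lies in the upper half-plane. -/
structure ArgChain (z : ℂ) (n : ℕ) (f : ℕ → ℂ) : Prop where
  im_pos : 0 < z.im
  ne_zero : ∀ j ≤ n, f j ≠ 0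
  le : ∀ k j, k ≤ j → j ≤ n → 0 ≤ (f j * (starRingEnd ℂ) (f k)).im
  le_mul : ∀ k j, k ≤ j → j ≤ n → 0 ≤ (z * f k * (starRingEnd ℂ) (f j)).im

open ComplexConjugate in
-- For `k ≤ j` cut the sum of `f` into blocks `A`, `B`, `C` at `k` and `j`. The new entries are `z A
-- + B + C` and `z (A + B) + C`, and both required imaginary parts expand into terms that are
-- nonnegative by the chain conditions between blocks.
theorem ArgChain.succ {z : ℂ} {n : ℕ} {f : ℕ → ℂ} (h : ArgChain z n f) :
    ArgChain z (n + 1)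
      fun j => z * ∑ k ∈ Finset.range j, f k + ∑ k ∈ Finset.Ico j (n + 1), f k := by
  have hz := h.im_pos
  have hle : ∀ s t : Finset ℕ, (∀ j ∈ s, ∀ k ∈ t, k ≤ j ∧ j ≤ n) →
      0 ≤ ((∑ j ∈ s, f j) * conj (∑ k ∈ t, f k)).im := fun s t hst =>
    im_sum_mul_conj_sum_nonneg fun j hj k hk => h.le k j (hst j hj k hk).1 (hst j hj k hk).2
  have hle_mul : ∀ s t : Finset ℕ, (∀ k ∈ s, ∀ j ∈ t, k ≤ j ∧ j ≤ n) →
      0 ≤ (z * (∑ k ∈ s, f k) * conj (∑ j ∈ t, f j)).im := fun s t hst => by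
    rw [Finset.mul_sum]
    exact im_sum_mul_conj_sum_nonneg fun k hk j hj =>
      h.le_mul k j (hst k hk j hj).1 (hst k hk j hj).2
  have expand1 : ∀ A B C : ℂ, ((z * (A + B) + C) * conj (z * A + (B + C))).im
      = (z * A * conj B).im + Complex.normSq z * (B * conj A).im + z.im * Complex.normSq B
        + (z * B * conj C).im + (C * conj B).im := by
    intro A B C
    simp only [map_add, map_mul, Complex.mul_im, Complex.mul_re, Complex.add_im, Complex.add_re,
      Complex.conj_im, Complex.conj_re, Complex.normSq_apply]
    ring
  have expand2 : ∀ A B C : ℂ, (z * (z * A + (B + C)) * conj (z * (A + B) + C)).im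
      = z.im * Complex.normSq (z * A + C) + Complex.normSq z * (z * A * conj B).im
        + Complex.normSq z * (C * conj B).im + Complex.normSq z * (B * conj A).im
        + (z * B * conj C).im := by
    intro A B C
    simp only [map_add, map_mul, Complex.mul_im, Complex.mul_re, Complex.add_im, Complex.add_re,
      Complex.conj_im, Complex.conj_re, Complex.normSq_apply]
    ring
  have split1 : ∀ k j, k ≤ j → ∑ i ∈ Finset.range j, f i
      = ∑ i ∈ Finset.range k, f i + ∑ i ∈ Finset.Ico k j, f i := fun k j hkj =>
    (Finset.sum_range_add_sum_Ico f hkj).symm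
  have split2 : ∀ k j, k ≤ j → j ≤ n + 1 → ∑ i ∈ Finset.Ico k (n + 1), f i
      = ∑ i ∈ Finset.Ico k j, f i + ∑ i ∈ Finset.Ico j (n + 1), f i := fun k j hkj hj =>
    (Finset.sum_Ico_consecutive f hkj hj).symm
  refine ⟨hz, ?_, ?_, ?_⟩
  · intro j hj h0
    rcases Nat.eq_zero_or_pos j with rfl | hpos
    -- Nonvanishing: pair with `z * f 0` here, and with `f i` when `j = i + 1`. One term is `Im z *
    -- |f i|²`, strictly positive, and the others are nonnegative.
    · have h1 : (z * f 0 * conj (z * ∑ k ∈ Finset.range 0, f k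
          + ∑ k ∈ Finset.Ico 0 (n + 1), f k)).im = (z * f 0 * conj (f 0)).im
          + (z * (∑ k ∈ {0}, f k) * conj (∑ k ∈ Finset.Ico 1 (n + 1), f k)).im := by
        rw [Finset.sum_eq_sum_Ico_succ_bot (Nat.succ_pos n)]
        simp [mul_add]
      rw [h0, im_mul_mul_conj_self] at h1
      have h2 := hle_mul {0} (Finset.Ico 1 (n + 1)) (by
        intro k hk j hj; simp at hk hj; omega)
      have h3 : 0 < z.im * Complex.normSq (f 0) :=
        mul_pos hz (Complex.normSq_pos.2 (h.ne_zero 0 (Nat.zero_le _)))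
      simp at h1 h2
      linarith
    · obtain ⟨i, rfl⟩ : ∃ i, j = i + 1 := ⟨j - 1, by omega⟩
      have h1 : ((z * ∑ k ∈ Finset.range (i + 1), f k
          + ∑ k ∈ Finset.Ico (i + 1) (n + 1), f k) * conj (f i)).im
          = (z * f i * conj (f i)).im + (z * (∑ k ∈ Finset.range i, f k) * conj (∑ k ∈ {i}, f k)).im
            + ((∑ k ∈ Finset.Ico (i + 1) (n + 1), f k) * conj (∑ k ∈ {i}, f k)).im := by
        rw [Finset.sum_range_succ, Finset.sum_singleton, ← Complex.add_im, ← Complex.add_im]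
        congr 1
        ring
      rw [h0, im_mul_mul_conj_self] at h1
      have h2 := hle_mul (Finset.range i) {i} (by intro k hk j hj; simp at hk hj; omega)
      have h3 := hle (Finset.Ico (i + 1) (n + 1)) {i} (by intro k hk j hj; simp at hk hj; omega)
      have h4 : 0 < z.im * Complex.normSq (f i) :=
        mul_pos hz (Complex.normSq_pos.2 (h.ne_zero i (by omega)))
      rw [zero_mul, Complex.zero_im] at h1
      linarith
  all_goals
    intro k j hkj hj
    rw [split1 k j hkj, split2 k j hkj hj]
    have hA := hle_mul (Finset.range k) (Finset.Ico k j) (by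
      intro a ha b hb; simp at ha hb; omega)
    have hB := hle (Finset.Ico k j) (Finset.range k) (by
      intro a ha b hb; simp at ha hb; omega)
    have hC := hle_mul (Finset.Ico k j) (Finset.Ico j (n + 1)) (by
      intro a ha b hb; simp at ha hb; omega)
    have hD := hle (Finset.Ico j (n + 1)) (Finset.Ico k j) (by
      intro a ha b hb; simp at ha hb; omega)
  · rw [expand1]
    have := Complex.normSq_nonneg z
    have := Complex.normSq_nonneg (∑ i ∈ Finset.Ico k j, f i)
    positivity
  · rw [expand2]
    have h1 := Complex.normSq_nonneg z
    have h2 := Complex.normSq_nonneg (∑ i ∈ Finset.Ico k j, f i)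
    have h3 := Complex.normSq_nonneg
      (z * ∑ i ∈ Finset.range k, f i + ∑ i ∈ Finset.Ico j (n + 1), f i)
    positivity

theorem argChain_eulerRefined {z : ℂ} (hz : 0 < z.im) (n : ℕ) :
    ArgChain z n fun j => aeval z (eulerRefined n j) := by
  induction n with
  | zero =>
    refine ⟨hz, ?_, ?_, ?_⟩ <;> intros <;> simp [eulerRefined_zero, hz.le]
  | succ n ih =>
    convert ih.succ using 2 with j
    rw [eulerRefined_succ, map_add, map_mul, aeval_X, map_sum, map_sum]

open ComplexConjugate in
/-- A nonnegative combination, not all of whose coefficients vanish, of a chain is nonzero. -/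
theorem ArgChain.sum_ne_zero {z : ℂ} {n : ℕ} {f : ℕ → ℂ} (h : ArgChain z n f) {P : ℕ → ℝ}
    (hP : ∀ j ≤ n, 0 ≤ P j) (hP0 : ∃ j ≤ n, P j ≠ 0) :
    ∑ j ∈ Finset.range (n + 1), (P j : ℂ) * f j ≠ 0 := by
  classical
  intro h0
  obtain ⟨hi, hPi⟩ := Nat.find_spec hP0
  set i := Nat.find hP0
  have hmin : ∀ j < i, P j = 0 := fun j hj => by
    by_contra hne
    exact Nat.find_min hP0 hj ⟨hj.le.trans hi, hne⟩
  -- All remaining terms have index at least `i`, so each lies within the window below `z * f i`,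
  -- and the term `i` itself strictly so.
  have h1 : 0 < (z * f i * conj (∑ j ∈ Finset.range (n + 1), (P j : ℂ) * f j)).im := by
    rw [map_sum, Finset.mul_sum, Complex.im_sum]
    have e : ∀ j, (z * f i * conj ((P j : ℂ) * f j)).im = P j * (z * f i * conj (f j)).im := by
      intro j
      rw [map_mul, Complex.conj_ofReal, ← Complex.im_ofReal_mul]
      congr 1
      ring
    simp only [e]
    refine Finset.sum_pos' (fun j hj => ?_) ⟨i, by simpa [Nat.lt_succ_iff] using hi, ?_⟩
    · have hj : j ≤ n := Nat.lt_succ_iff.1 (Finset.mem_range.1 hj)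
      rcases lt_or_ge j i with hlt | hge
      · simp [hmin j hlt]
      · exact mul_nonneg (hP j hj) (h.le_mul i j hge hj)
    · rw [im_mul_mul_conj_self]
      exact mul_pos (lt_of_le_of_ne (hP i hi) (Ne.symm hPi))
        (mul_pos h.im_pos (Complex.normSq_pos.2 (h.ne_zero i hi)))
  rw [h0] at h1
  simp at h1

open ComplexConjugate in
-- Antisymmetry of `Im (f j * conj (f k))` allows antisymmetrizing the weights: twice the double sum
-- has the terms `(U j V k - U k V j) Im (f j * conj (f k))`, whose two factors never have opposite
-- signs.
theorem ArgChain.im_sum_mul_conj_sum_nonneg {z : ℂ} {n : ℕ} {f : ℕ → ℂ} (h : ArgChain z n f)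
    {U V : ℕ → ℝ} (hUV : ∀ k j, k ≤ j → j ≤ n → U k * V j ≤ U j * V k) :
    0 ≤ ((∑ j ∈ Finset.range (n + 1), (U j : ℂ) * f j)
      * conj (∑ k ∈ Finset.range (n + 1), (V k : ℂ) * f k)).im := by
  have e : ((∑ j ∈ Finset.range (n + 1), (U j : ℂ) * f j)
      * conj (∑ k ∈ Finset.range (n + 1), (V k : ℂ) * f k)).im
      = ∑ j ∈ Finset.range (n + 1), ∑ k ∈ Finset.range (n + 1),
        U j * V k * (f j * conj (f k)).im := by
    rw [map_sum, Finset.sum_mul_sum, Complex.im_sum]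
    refine Finset.sum_congr rfl fun j _ => ?_
    rw [Complex.im_sum]
    refine Finset.sum_congr rfl fun k _ => ?_
    rw [map_mul, Complex.conj_ofReal, ← Complex.im_ofReal_mul]
    congr 1
    push_cast
    ring
  have anti : ∀ j k, (f k * conj (f j)).im = -(f j * conj (f k)).im := by
    intro j k
    rw [← Complex.conj_im, map_mul, Complex.conj_conj, mul_comm]
  have e2 : (2 : ℝ) * ∑ j ∈ Finset.range (n + 1), ∑ k ∈ Finset.range (n + 1),
        U j * V k * (f j * conj (f k)).im
      = ∑ j ∈ Finset.range (n + 1), ∑ k ∈ Finset.range (n + 1),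
        (U j * V k - U k * V j) * (f j * conj (f k)).im := by
    rw [two_mul]
    nth_rewrite 2 [Finset.sum_comm]
    rw [← Finset.sum_add_distrib]
    refine Finset.sum_congr rfl fun j _ => ?_
    rw [← Finset.sum_add_distrib]
    refine Finset.sum_congr rfl fun k _ => ?_
    rw [anti j k]
    ring
  rw [e]
  refine nonneg_of_mul_nonneg_right (a := (2 : ℝ)) ?_ two_pos
  rw [e2]
  refine Finset.sum_nonneg fun j hj => Finset.sum_nonneg fun k hk => ?_
  have hj : j ≤ n := Nat.lt_succ_iff.1 (Finset.mem_range.1 hj)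
  have hk : k ≤ n := Nat.lt_succ_iff.1 (Finset.mem_range.1 hk)
  rcases le_total k j with hkj | hjk
  · exact mul_nonneg (sub_nonneg.2 (hUV k j hkj hj)) (h.le k j hkj hj)
  · refine mul_nonneg_of_nonpos_of_nonpos (sub_nonpos.2 (hUV j k hjk hk)) ?_
    have := h.le j k hjk hk
    rw [anti j k] at this
    linarith

open ComplexConjugate in
/-- If `U` and `W` lie in the cone spanned by `e` and `z e` and `W` is left of `U`, then `z U` is
left of `W`. -/
theorem im_mul_mul_conj_nonneg_of_mem_cone {z e U W : ℂ} (hz : 0 < z.im) (he : e ≠ 0)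
    (hU : 0 ≤ (U * conj e).im) (hU' : 0 ≤ (z * e * conj U).im) (hW : 0 ≤ (W * conj e).im)
    (hW' : 0 ≤ (z * e * conj W).im) (hWU : 0 ≤ (W * conj U).im) :
    0 ≤ (z * U * conj W).im := by
  -- Coordinates of a point of the cone in the real basis `e`, `z e`.
  have key : ∀ V : ℂ, 0 ≤ (V * conj e).im → 0 ≤ (z * e * conj V).im →
      ∃ s t : ℝ, 0 ≤ s ∧ 0 ≤ t ∧ V = (s + t * z) * e := by
    intro V h1 h2
    have hV : V = V / e * e := by field_simp
    set v := V / e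
    have hne := Complex.normSq_pos.2 he
    have h1' : (V * conj e).im = v.im * Complex.normSq e := by
      rw [hV, mul_assoc, Complex.mul_conj, Complex.im_mul_ofReal]
    have h2' : (z * e * conj V).im = (z * conj v).im * Complex.normSq e := by
      rw [hV, map_mul, ← Complex.im_mul_ofReal, ← Complex.mul_conj]
      congr 1
      ring
    rw [h1'] at h1
    rw [h2'] at h2
    have h3 : 0 ≤ v.im := nonneg_of_mul_nonneg_left h1 hne
    have h4 : 0 ≤ (z * conj v).im := nonneg_of_mul_nonneg_left h2 hne
    refine ⟨(z * conj v).im / z.im, v.im / z.im, by positivity, by positivity, ?_⟩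
    conv_lhs => rw [hV]
    congr 1
    apply Complex.ext
    · simp
      field_simp
      ring
    · simp
      field_simp
  obtain ⟨s, t, hs, ht, rfl⟩ := key U hU hU'
  obtain ⟨s', t', hs', ht', rfl⟩ := key W hW hW'
  have hne := Complex.normSq_pos.2 he
  have h1 : ((s' + t' * z) * e * conj ((s + t * z) * e)).im
      = (t' * s - s' * t) * (z.im * Complex.normSq e) := by
    simp [Complex.normSq_apply]
    ring
  rw [h1] at hWU
  have h2 : 0 ≤ t' * s - s' * t := nonneg_of_mul_nonneg_left hWU (mul_pos hz hne)
  have h3 : (z * ((s + t * z) * e) * conj ((s' + t' * z) * e)).im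
      = (s * s' + t * t' * Complex.normSq z + 2 * (s' * t) * z.re) * (z.im * Complex.normSq e) := by
    simp [Complex.normSq_apply]
    ring
  rw [h3]
  refine mul_nonneg ?_ (mul_pos hz hne).le
  -- That `W` is left of `U` means `s' t ≤ s t'`. With `|Re z| ≤ |z|`, the mixed term is then
  -- controlled by the arithmetic–geometric mean inequality for `s s'` and `t t' |z|²`.
  have h4 : (s' * t) ^ 2 ≤ (s * s') * (t * t') := by
    have := mul_nonneg (mul_nonneg hs' ht) h2
    nlinarith
  have h5 : z.re ^ 2 ≤ Complex.normSq z := by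
    rw [Complex.normSq_apply]; nlinarith [sq_nonneg z.im]
  have h6 : |2 * (s' * t) * z.re| ≤ s * s' + t * t' * Complex.normSq z := by
    apply abs_le_of_sq_le_sq _ (by have := Complex.normSq_nonneg z; positivity)
    have h7 : (s' * t) ^ 2 * z.re ^ 2 ≤ (s * s') * (t * t') * Complex.normSq z :=
      mul_le_mul h4 h5 (sq_nonneg _) (by positivity)
    nlinarith [sq_nonneg (s * s' - t * t' * Complex.normSq z)]
  linarith [neg_abs_le (2 * (s' * t) * z.re)]

/-! ### Hermite–Biehler by counting zeros through arguments -/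

theorem splits_of_aeval_ne_zero {f : ℝ[X]} (hf : ∀ z : ℂ, 0 < z.im → aeval z f ≠ 0) :
    f.Splits := by
  refine Splits.of_splits_map (algebraMap ℝ ℂ) (IsAlgClosed.splits _) fun z hz => ?_
  have hz0 : aeval z f = 0 := by
    rw [aeval_def, ← eval_map]
    exact isRoot_of_mem_roots hz
  have him : z.im = 0 := by
    rcases lt_trichotomy z.im 0 with h | h | h
    · refine absurd ?_ (hf ((starRingEnd ℂ) z) (by simpa using h))
      rw [aeval_conj, hz0, map_zero]
    · exact h
    · exact absurd hz0 (hf z h)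
  exact ⟨z.re, Complex.ext (by simp) (by simp [him])⟩

/-- The argument of `x + i`, lying in `(0, π)`. -/
noncomputable def upperArg (x : ℝ) : ℝ := Real.pi / 2 - Real.arctan x

theorem continuous_upperArg : Continuous upperArg :=
  continuous_const.sub Real.continuous_arctan

open Filter Topology in
theorem tendsto_upperArg_atTop : Tendsto upperArg atTop (𝓝 0) := by
  have h := (tendsto_const_nhds (x := Real.pi / 2)).sub
    (tendsto_nhds_of_tendsto_nhdsWithin Real.tendsto_arctan_atTop)
  rwa [sub_self] at h

open Filter Topology in
theorem tendsto_upperArg_atBot : Tendsto upperArg atBot (𝓝 Real.pi) := by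
  have h := (tendsto_const_nhds (x := Real.pi / 2)).sub
    (tendsto_nhds_of_tendsto_nhdsWithin Real.tendsto_arctan_atBot)
  rwa [sub_neg_eq_add, add_halves] at h

theorem exists_polar_upperArg {ε : ℝ} (hε : 0 < ε) (x : ℝ) :
    ∃ ρ : ℝ, 0 < ρ ∧ (x + ε * Complex.I : ℂ) = ρ * Complex.exp (upperArg (x / ε) * Complex.I) := by
  have hs : 0 < √(1 + (x / ε) ^ 2) := Real.sqrt_pos.2 (by positivity)
  refine ⟨ε * √(1 + (x / ε) ^ 2), by positivity, ?_⟩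
  rw [Complex.exp_mul_I, ← Complex.ofReal_cos, ← Complex.ofReal_sin, upperArg,
    Real.cos_pi_div_two_sub, Real.sin_pi_div_two_sub, Real.sin_arctan, Real.cos_arctan]
  have hx : ε * √(1 + (x / ε) ^ 2) * (x / ε / √(1 + (x / ε) ^ 2)) = x := by field_simp
  have hy : ε * √(1 + (x / ε) ^ 2) * (1 / √(1 + (x / ε) ^ 2)) = ε := by field_simp
  rw [mul_add, ← mul_assoc, ← Complex.ofReal_mul, ← Complex.ofReal_mul, hx, hy]

/-- The sum of the arguments of `u + i ε - r`, where `r` ranges over `s`. -/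
noncomputable def sumUpperArg (s : Multiset ℝ) (ε u : ℝ) : ℝ :=
  (s.map fun r => upperArg ((u - r) / ε)).sum

theorem sumUpperArg_cons (r : ℝ) (s : Multiset ℝ) (ε u : ℝ) :
    sumUpperArg (r ::ₘ s) ε u = upperArg ((u - r) / ε) + sumUpperArg s ε u := by
  simp [sumUpperArg]

theorem exists_polar_prod_sub (s : Multiset ℝ) {ε : ℝ} (hε : 0 < ε) (u : ℝ) :
    ∃ ρ : ℝ, 0 < ρ ∧ (s.map fun r : ℝ => (u + ε * Complex.I - r : ℂ)).prod
      = ρ * Complex.exp (sumUpperArg s ε u * Complex.I) := by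
  induction s using Multiset.induction with
  | empty => exact ⟨1, one_pos, by simp [sumUpperArg]⟩
  | cons r s ih =>
    obtain ⟨ρ, hρ, h⟩ := ih
    obtain ⟨ρ', hρ', h'⟩ := exists_polar_upperArg hε (u - r)
    refine ⟨ρ' * ρ, mul_pos hρ' hρ, ?_⟩
    rw [Multiset.map_cons, Multiset.prod_cons, h, sumUpperArg_cons, Complex.ofReal_add, add_mul,
      Complex.exp_add, add_sub_right_comm, ← Complex.ofReal_sub, h', Complex.ofReal_mul]
    ring

theorem continuous_sumUpperArg (s : Multiset ℝ) (ε : ℝ) : Continuous (sumUpperArg s ε) :=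
  continuous_multiset_sum s fun _ _ =>
    continuous_upperArg.comp ((continuous_id.sub continuous_const).div_const ε)

open Filter Topology in
theorem tendsto_sumUpperArg_atTop (s : Multiset ℝ) {ε : ℝ} (hε : 0 < ε) :
    Tendsto (sumUpperArg s ε) atTop (𝓝 0) := by
  induction s using Multiset.induction with
  | empty => exact tendsto_const_nhds.congr fun u => by simp [sumUpperArg]
  | cons r s ih =>
    have h := tendsto_upperArg_atTop.comp
      ((tendsto_atTop_add_const_right atTop (-r) tendsto_id).atTop_div_const hε)
    have := h.add ih
    rw [add_zero] at this
    refine this.congr fun u => ?_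
    simp [sumUpperArg_cons, sub_eq_add_neg]

open Filter Topology in
-- As the line descends to the real axis, a zero to the right of `t` contributes `π` and one to the
-- left contributes `0`.
theorem tendsto_sumUpperArg_nhdsGT_zero (s : Multiset ℝ) {t : ℝ} (ht : t ∉ s) :
    Tendsto (fun ε => sumUpperArg s ε t) (𝓝[>] 0) (𝓝 (s.countP (t < ·) * Real.pi)) := by
  induction s using Multiset.induction with
  | empty => simp [sumUpperArg]
  | cons r s ih =>
    rw [Multiset.mem_cons, not_or] at ht
    simp only [sumUpperArg_cons, Multiset.countP_cons]
    have hinv : Tendsto (fun ε : ℝ => ε⁻¹) (𝓝[>] 0) atTop := tendsto_inv_nhdsGT_zero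
    rcases lt_or_gt_of_ne ht.1 with h | h
    · have h1 := tendsto_upperArg_atBot.comp
        (hinv.const_mul_atTop_of_neg (sub_neg.2 h))
      have := h1.add (ih ht.2)
      rw [if_pos h, Nat.cast_add, Nat.cast_one, add_mul, one_mul, add_comm (_ * Real.pi)]
      exact this.congr fun ε => by simp [div_eq_mul_inv]
    · have h1 := tendsto_upperArg_atTop.comp (hinv.const_mul_atTop (sub_pos.2 h))
      have := h1.add (ih ht.2)
      rw [if_neg h.not_gt, add_zero]
      rw [zero_add] at this
      exact this.congr fun ε => by simp [div_eq_mul_inv]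

open Filter Topology in
-- `D` starts from `0` at infinity and, by the intermediate value theorem, cannot enter `(-π, 0)` or
-- `(π, 2π)`, where the sine is negative.
theorem mem_Icc_zero_pi_of_sin_nonneg {D : ℝ → ℝ} (hD : Continuous D)
    (h0 : Tendsto D atTop (𝓝 0)) (hsin : ∀ u, 0 ≤ Real.sin (D u)) (t : ℝ) :
    0 ≤ D t ∧ D t ≤ Real.pi := by
  have hpi := Real.pi_pos
  constructor
  · by_contra! hlt
    -- The cut-off at `-π/2` keeps the intermediate value inside `(-π, 0)` however small `D t` is.
    have hc : max (D t) (-(Real.pi / 2)) < 0 := max_lt hlt (by linarith)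
    obtain ⟨T, hT, htT⟩ := ((h0.eventually (lt_mem_nhds hc)).and (eventually_ge_atTop t)).exists
    obtain ⟨u, -, hu⟩ := intermediate_value_Icc htT hD.continuousOn ⟨le_max_left _ _, hT.le⟩
    have := hsin u
    rw [hu] at this
    exact absurd this (not_le.2 (Real.sin_neg_of_neg_of_neg_pi_lt hc
      (lt_max_of_lt_right (by linarith))))
  · by_contra! hlt
    have hc : Real.pi < min (D t) (Real.pi + Real.pi / 2) := lt_min hlt (by linarith)
    obtain ⟨T, hT, htT⟩ := ((h0.eventually (gt_mem_nhds (hpi.trans hc))).and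
      (eventually_ge_atTop t)).exists
    obtain ⟨u, -, hu⟩ := intermediate_value_Icc' htT hD.continuousOn ⟨hT.le, min_le_left _ _⟩
    have h1 := hsin u
    rw [hu, ← sub_add_cancel (min (D t) (Real.pi + Real.pi / 2)) Real.pi, Real.sin_add_pi] at h1
    have h2 : min (D t) (Real.pi + Real.pi / 2) ≤ Real.pi + Real.pi / 2 := min_le_right _ _
    have := Real.sin_pos_of_pos_of_lt_pi (sub_pos.2 hc) (by linarith)
    linarith

open ComplexConjugate in
-- On each line `Im z = ε` the difference of the arguments of `f` and `g` stays in `[0, π]`. As `ε →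
-- 0` it tends to `π` times the difference of the numbers of zeros beyond `t`.
theorem countP_roots_of_im_mul_conj_nonneg {f g : ℝ[X]} (hf : f.Splits) (hg : g.Splits)
    (hpos : 0 < f.leadingCoeff * g.leadingCoeff)
    (h : ∀ z : ℂ, 0 < z.im → 0 ≤ (aeval z f * conj (aeval z g)).im) {t : ℝ}
    (htf : t ∉ f.roots) (htg : t ∉ g.roots) :
    g.roots.countP (t < ·) ≤ f.roots.countP (t < ·) ∧
      f.roots.countP (t < ·) ≤ g.roots.countP (t < ·) + 1 := by
  have heval : ∀ {q : ℝ[X]}, q.Splits → ∀ z : ℂ,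
      aeval z q = q.leadingCoeff * (q.roots.map fun r : ℝ => z - r).prod := by
    intro q hq z
    conv_lhs => rw [hq.eq_prod_roots]
    rw [map_mul, aeval_C, map_multiset_prod, Multiset.map_map]
    simp
  have hmem : ∀ ε > 0, ∀ u, 0 ≤ sumUpperArg f.roots ε u - sumUpperArg g.roots ε u ∧
      sumUpperArg f.roots ε u - sumUpperArg g.roots ε u ≤ Real.pi := by
    intro ε hε u
    refine mem_Icc_zero_pi_of_sin_nonneg
      (D := fun u => sumUpperArg f.roots ε u - sumUpperArg g.roots ε u)
      ((continuous_sumUpperArg _ _).sub (continuous_sumUpperArg _ _))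
      (sub_zero (0 : ℝ) ▸ (tendsto_sumUpperArg_atTop f.roots hε).sub
        (tendsto_sumUpperArg_atTop g.roots hε)) (fun u => ?_) u
    obtain ⟨ρ, hρ, h1⟩ := exists_polar_prod_sub f.roots hε u
    obtain ⟨σ, hσ, h2⟩ := exists_polar_prod_sub g.roots hε u
    have h3 := h (u + ε * Complex.I) (by simpa using hε)
    rw [heval hf, heval hg, h1, h2] at h3
    have h4 : f.leadingCoeff * (ρ * Complex.exp (sumUpperArg f.roots ε u * Complex.I))
        * conj (g.leadingCoeff * (σ * Complex.exp (sumUpperArg g.roots ε u * Complex.I)))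
        = ((f.leadingCoeff * g.leadingCoeff * (ρ * σ) : ℝ) : ℂ) * Complex.exp
          ((sumUpperArg f.roots ε u - sumUpperArg g.roots ε u : ℝ) * Complex.I) := by
      rw [map_mul, map_mul, ← Complex.exp_conj, map_mul, Complex.conj_I, Complex.conj_ofReal,
        Complex.conj_ofReal, Complex.conj_ofReal, Complex.ofReal_sub, sub_mul, sub_eq_add_neg,
        Complex.exp_add, mul_neg]
      push_cast
      ring
    rw [h4, Complex.im_ofReal_mul, Complex.exp_ofReal_mul_I_im] at h3
    exact nonneg_of_mul_nonneg_right h3 (mul_pos hpos (mul_pos hρ hσ))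
  have hlim := (tendsto_sumUpperArg_nhdsGT_zero f.roots htf).sub
    (tendsto_sumUpperArg_nhdsGT_zero g.roots htg)
  have hev : ∀ᶠ ε : ℝ in nhdsWithin 0 (Set.Ioi 0), 0 < ε := self_mem_nhdsWithin
  have h1 := ge_of_tendsto hlim (hev.mono fun ε hε => (hmem ε hε t).1)
  have h2 := le_of_tendsto hlim (hev.mono fun ε hε => (hmem ε hε t).2)
  have hpi := Real.pi_pos
  constructor
  · have : (g.roots.countP (t < ·) : ℝ) ≤ f.roots.countP (t < ·) :=
      le_of_mul_le_mul_right (by linarith) hpi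
    exact_mod_cast this
  · have : (f.roots.countP (t < ·) : ℝ) ≤ g.roots.countP (t < ·) + 1 :=
      le_of_mul_le_mul_right (by linarith) hpi
    exact_mod_cast this

theorem Multiset.exists_antitone_map {d : ℕ} (s : Multiset ℝ) (hs : s.card = d) :
    ∃ r : Fin d → ℝ, Antitone r ∧ s = Finset.univ.val.map r := by
  subst hs
  have hlen : (s.sort (· ≥ ·)).length = s.card := Multiset.length_sort _
  refine ⟨fun i => (s.sort (· ≥ ·)).get (i.cast hlen.symm), fun i j hij => ?_, ?_⟩
  · exact (Multiset.pairwise_sort s (· ≥ ·)).rel_get_of_le (by simpa using hij)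
  · conv_lhs => rw [← Multiset.sort_eq s (· ≥ ·)]
    rw [Fin.univ_val_map]
    congr 1
    apply List.ext_get <;> simp

theorem lt_iff_succ_le_countP_map {d : ℕ} {r : Fin d → ℝ} (hr : Antitone r) {t : ℝ} {i : Fin d} :
    t < r i ↔ (i : ℕ) + 1 ≤ (Finset.univ.val.map r).countP (t < ·) := by
  have hcard : (Finset.univ.val.map r).countP (t < ·)
      = (Finset.univ.filter fun j => t < r j).card := by
    rw [Multiset.countP_map]; rfl
  rw [hcard]
  constructor
  · intro h
    rw [← Fin.card_Iic]
    exact Finset.card_le_card fun j hj => by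
      simpa using h.trans_le (hr (Finset.mem_Iic.1 hj))
  · intro h
    by_contra hlt
    have : (Finset.univ.filter fun j => t < r j).card ≤ (Finset.Iio i).card :=
      Finset.card_le_card fun j hj => by
        rw [Finset.mem_Iio]
        by_contra hij
        exact hlt ((Finset.mem_filter.1 hj).2.trans_le (hr (not_lt.1 hij)))
    rw [Fin.card_Iio] at this
    omega

/-- A violated interlacing inequality leaves a gap containing some `t` that is no zero, and the
counts at `t` contradict `h`. A `t` below all zeros compares the degrees. -/
theorem preceq_of_countP_roots {f g : ℝ[X]} (hf : f.Splits) (hg : g.Splits) (hf0 : f ≠ 0)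
    (hg0 : g ≠ 0) (h : ∀ t, t ∉ f.roots → t ∉ g.roots →
      g.roots.countP (t < ·) ≤ f.roots.countP (t < ·) ∧
        f.roots.countP (t < ·) ≤ g.roots.countP (t < ·) + 1) :
    Preceq g f := by
  have hcard : g.roots.card ≤ f.roots.card ∧ f.roots.card ≤ g.roots.card + 1 := by
    obtain ⟨t, ht⟩ := (f.roots + g.roots).toFinset.finite_toSet.bddBelow
    have ht' : ∀ r ∈ f.roots + g.roots, t - 1 < r := fun r hr => by
      have := ht (show r ∈ ((f.roots + g.roots).toFinset : Set ℝ) by simpa using hr)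
      linarith
    have h1 := h (t - 1) (fun h => (ht' _ (Multiset.mem_add.2 (Or.inl h))).false)
      fun h => (ht' _ (Multiset.mem_add.2 (Or.inr h))).false
    rwa [Multiset.countP_eq_card.2 fun r hr => ht' r (Multiset.mem_add.2 (Or.inl hr)),
      Multiset.countP_eq_card.2 fun r hr => ht' r (Multiset.mem_add.2 (Or.inr hr))] at h1
  have hprod : ∀ {q : ℝ[X]} {d : ℕ} {r : Fin d → ℝ}, q.Splits → q.roots = Finset.univ.val.map r →
      q = C q.leadingCoeff * ∏ i, (X - C (r i)) := by
    intro q d r hq hr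
    conv_lhs => rw [hq.eq_prod_roots, hr, Multiset.map_map]
    rfl
  have hgen : ∀ x y : ℝ, x < y → ∃ t, x < t ∧ t < y ∧ t ∉ f.roots ∧ t ∉ g.roots := by
    intro x y hxy
    obtain ⟨t, ht, ht'⟩ := ((Set.Ioo_infinite hxy).sdiff
      (f.roots + g.roots).toFinset.finite_toSet).nonempty
    refine ⟨t, ht.1, ht.2, fun h => ht' ?_, fun h => ht' ?_⟩ <;> simp_all
  obtain ⟨s, hs, hsg⟩ := g.roots.exists_antitone_map rfl
  have key : ∀ {d : ℕ} (r : Fin d → ℝ), Antitone r → f.roots = Finset.univ.val.map r →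
      (∀ (i : Fin d) (j : Fin g.roots.card), (i : ℕ) = j → s j ≤ r i) ∧
      ∀ (i : Fin d) (j : Fin g.roots.card), (i : ℕ) = j + 1 → r i ≤ s j := by
    intro d r hr hrf
    constructor <;> intro i j hij <;> by_contra! hlt
    · obtain ⟨t, h1, h2, h3, h4⟩ := hgen _ _ hlt
      have h5 := (h t h3 h4).1
      rw [hsg, hrf] at h5
      have := (lt_iff_succ_le_countP_map hs).1 h2
      exact absurd ((lt_iff_succ_le_countP_map hr).2 (by omega)) h1.not_gt
    · obtain ⟨t, h1, h2, h3, h4⟩ := hgen _ _ hlt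
      have h5 := (h t h3 h4).2
      rw [hsg, hrf] at h5
      have := (lt_iff_succ_le_countP_map hr).1 h2
      exact absurd ((lt_iff_succ_le_countP_map hs).2 (by omega)) h1.not_gt
  have hlf := leadingCoeff_ne_zero.2 hf0
  have hlg := leadingCoeff_ne_zero.2 hg0
  rcases Nat.lt_or_ge g.roots.card f.roots.card with hlt | hge
  · obtain ⟨r, hr, hrf⟩ := f.roots.exists_antitone_map (d := g.roots.card + 1) (by omega)
    obtain ⟨h1, h2⟩ := key r hr hrf
    exact Or.inl ⟨_, r, s, _, _, hlf, hlg, hprod hf hrf, hprod hg hsg, fun i =>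
      ⟨h2 _ i (by simp), h1 _ i (by simp)⟩⟩
  · obtain ⟨r, hr, hrf⟩ := f.roots.exists_antitone_map (d := g.roots.card) (by omega)
    obtain ⟨h1, h2⟩ := key r hr hrf
    refine Or.inr ⟨_, r, s, _, _, hlf, hlg, hprod hf hrf, hprod hg hsg, fun i => h1 i i rfl,
      fun i j hij => ?_⟩
    have hi : (i : ℕ) + 1 < g.roots.card := by have := j.2; have := Fin.lt_def.1 hij; omega
    exact (hr (show (⟨i + 1, hi⟩ : Fin _) ≤ j from Fin.le_def.2 (Fin.lt_def.1 hij))).trans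
      (h2 _ i rfl)

open ComplexConjugate in
/-- A form of the Hermite–Biehler theorem. -/
theorem LL_of_im_mul_conj_nonneg {f g : ℝ[X]} (hf0 : f ≠ 0) (hg0 : g ≠ 0)
    (hf : ∀ z : ℂ, 0 < z.im → aeval z f ≠ 0) (hg : ∀ z : ℂ, 0 < z.im → aeval z g ≠ 0)
    (h : ∀ z : ℂ, 0 < z.im → 0 ≤ (aeval z f * conj (aeval z g)).im) : LL g f := by
  have hfs := splits_of_aeval_ne_zero hf
  have hgs := splits_of_aeval_ne_zero hg
  have hlf := leadingCoeff_ne_zero.2 hf0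
  have hlg := leadingCoeff_ne_zero.2 hg0
  rcases lt_or_gt_of_ne (mul_ne_zero hlg hlf) with hneg | hpos
  · refine Or.inr (Or.inl ⟨preceq_of_countP_roots hgs hfs hg0 hf0 fun t htg htf => ?_, hneg⟩)
    -- For opposite signs, `(-g, f)` takes the place of `(f, g)`: `-g conj f` and `f conj g` have
    -- the same imaginary part.
    have := countP_roots_of_im_mul_conj_nonneg (f := -g) (g := f) hgs.neg hfs
      (by rw [leadingCoeff_neg]; linarith) (fun z hz => ?_) (by rwa [roots_neg]) htf
    · rwa [roots_neg] at this
    · have e : aeval z (-g) * conj (aeval z f) = -conj (aeval z f * conj (aeval z g)) := by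
        rw [map_neg, map_mul, Complex.conj_conj]
        ring
      rw [e, Complex.neg_im, Complex.conj_im, neg_neg]
      exact h z hz
  · exact Or.inl ⟨preceq_of_countP_roots hfs hgs hf0 hg0 fun t htf htg =>
      countP_roots_of_im_mul_conj_nonneg hfs hgs (by linarith) h htf htg, hpos⟩

/-! ### Likelihood ratio order and the weights of `p` -/

/-- The likelihood ratio order of two log-concave sequences `u` and `v`, where `u` is shifted to the
right of `v`. -/
def LikelihoodLE (v u : ℤ → ℝ) : Prop :=
  ∀ a b c e : ℤ, e ≤ a → e ≤ b → a ≤ c → b ≤ c → a + b = c + e → v c * u e ≤ v a * u b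

/-- Adding one independent trial to each side keeps the order if the trial for `v` succeeds at least
as often. The four-index form of the order is what makes this induction close. -/
theorem LikelihoodLE.step {v u : ℤ → ℝ} (h : LikelihoodLE v u) {s s' : ℝ} (hs : 0 ≤ s)
    (hss' : s ≤ s') (hs' : s' ≤ 1) :
    LikelihoodLE (fun i => (1 - s') * v (i - 1) + s' * v i)
      fun i => (1 - s) * u (i - 1) + s * u i := by
  intro a b c e hea heb hac hbc hsum
  simp only
  rcases eq_or_ne e c with rfl | hec
  · obtain rfl : a = e := le_antisymm hac hea
    obtain rfl : b = a := le_antisymm hbc heb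
    rfl
  have h1 : 0 ≤ (1 - s') * (1 - s) * (v (a - 1) * u (b - 1) - v (c - 1) * u (e - 1)) :=
    mul_nonneg (mul_nonneg (by linarith) (by linarith))
      (sub_nonneg.2 (h _ _ _ _ (by omega) (by omega) (by omega) (by omega) (by omega)))
  have h2 : 0 ≤ s' * s * (v a * u b - v c * u e) :=
    mul_nonneg (mul_nonneg (by linarith) hs) (sub_nonneg.2 (h _ _ _ _ hea heb hac hbc hsum))
  have h3 : v c * u (e - 1) ≤ v a * u (b - 1) :=
    h _ _ _ _ (by omega) (by omega) (by omega) (by omega) (by omega)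
  have h4 : 0 ≤ (1 - s') * s := mul_nonneg (by linarith) hs
  have h5 : 0 ≤ s' * (1 - s) := mul_nonneg (by linarith) (by linarith)
  have h6 : 0 ≤ (1 - s') * s * (v (a - 1) * u b - v (c - 1) * u e)
      + s' * (1 - s) * (v a * u (b - 1) - v c * u (e - 1)) := by
    rcases eq_or_ne a e with rfl | hae
    -- Here `v (a-1) * u b` is not the larger side of an available comparison with `v (c-1) * u e`.
    -- The two mixed terms are recombined crosswise with the common weight `(1 - s') s`, and the
    -- surplus weight `s' - s` goes to `h3`.
    · obtain rfl : b = c := by omega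
      have h7 : v (b - 1) * u a ≤ v a * u (b - 1) :=
        h _ _ _ _ (by omega) (by omega) (by omega) (by omega) (by omega)
      have h8 : v b * u (a - 1) ≤ v (a - 1) * u b :=
        h _ _ _ _ (by omega) (by omega) (by omega) (by omega) (by omega)
      have h9 := mul_nonneg h4 (add_nonneg (sub_nonneg.2 h7) (sub_nonneg.2 h8))
      have h10 := mul_nonneg (sub_nonneg.2 hss') (sub_nonneg.2 h3)
      linarith
    · have h7 : v (c - 1) * u e ≤ v (a - 1) * u b :=
        h _ _ _ _ (by omega) (by omega) (by omega) (by omega) (by omega)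
      exact add_nonneg (mul_nonneg h4 (sub_nonneg.2 h7)) (mul_nonneg h5 (sub_nonneg.2 h3))
  linarith

/-- The coefficients of a polynomial, indexed by the integers. -/
noncomputable def intCoeff (q : ℝ[X]) (i : ℤ) : ℝ := if 0 ≤ i then q.coeff i.toNat else 0

theorem intCoeff_natCast (q : ℝ[X]) (i : ℕ) : intCoeff q i = q.coeff i := by simp [intCoeff]

theorem intCoeff_mul (α s : ℝ) (q : ℝ[X]) (i : ℤ) :
    intCoeff ((C α * X + C s) * q) i = α * intCoeff q (i - 1) + s * intCoeff q i := by
  rw [add_mul, mul_assoc]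
  rcases lt_trichotomy i 0 with h | rfl | h
  · simp [intCoeff, h.not_ge, show ¬ (1 : ℤ) ≤ i by omega]
  · simp [intCoeff]
  · obtain ⟨k, rfl⟩ : ∃ k : ℕ, i = (k : ℤ) + 1 := ⟨(i - 1).toNat, by omega⟩
    rw [add_sub_cancel_right, intCoeff_natCast]
    have : ((k : ℤ) + 1) = ((k + 1 : ℕ) : ℤ) := by push_cast; rfl
    rw [this, intCoeff_natCast, intCoeff_natCast]
    simp

/-- The generating function of the number of failures among independent trials that succeed with
the probabilities `r i`. -/
noncomputable def failurePoly {n : ℕ} (r : Fin n → ℝ) : ℝ[X] := ∏ i, (C (1 - r i) * X + C (r i))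

theorem likelihoodLE_failurePoly {n : ℕ} : ∀ {r r' : Fin n → ℝ}, (∀ i, 0 ≤ r i) →
    (∀ i, r i ≤ r' i) → (∀ i, r' i ≤ 1) →
    LikelihoodLE (intCoeff (failurePoly r')) (intCoeff (failurePoly r)) := by
  induction n with
  | zero =>
    intro r r' _ _ _ a b c e hea heb hac hbc hsum
    simp only [failurePoly, Finset.univ_eq_empty, Finset.prod_empty, intCoeff, coeff_one]
    split_ifs <;> first | omega | norm_num
  | succ n ih =>
    intro r r' h0 h1 h2
    have := (ih (fun i => h0 i.succ) (fun i => h1 i.succ) fun i => h2 i.succ).step (h0 0) (h1 0)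
      (h2 0)
    unfold failurePoly at this ⊢
    simpa only [Fin.prod_univ_succ, ← intCoeff_mul] using this

theorem natDegree_failurePoly_le {n : ℕ} (r : Fin n → ℝ) : (failurePoly r).natDegree ≤ n := by
  refine (natDegree_prod_le _ _).trans ((Finset.sum_le_sum fun i _ => natDegree_linear_le).trans ?_)
  simp

theorem coeff_failurePoly_nonneg {n : ℕ} {r : Fin n → ℝ} (h0 : ∀ i, 0 ≤ r i)
    (h1 : ∀ i, r i ≤ 1) (j : ℕ) : 0 ≤ (failurePoly r).coeff j := by
  have : ∀ (s : Finset (Fin n)) j, 0 ≤ (∏ i ∈ s, (C (1 - r i) * X + C (r i))).coeff j := by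
    intro s
    induction s using Finset.induction with
    | empty => intro j; rw [Finset.prod_empty, coeff_one]; split_ifs <;> norm_num
    | insert i s hi ih =>
      intro j
      rw [Finset.prod_insert hi, add_mul, mul_assoc, coeff_add, coeff_C_mul, coeff_C_mul]
      refine add_nonneg (mul_nonneg (sub_nonneg.2 (h1 i)) ?_) (mul_nonneg (h0 i) (ih j))
      cases j with
      | zero => simp
      | succ j => rw [coeff_X_mul]; exact ih j
  exact this _ j

/-- Reflection swaps success and failure. The reversal `i.rev` merely permutes the factors, so that
they match the pairing in the hypothesis on `r k i + r l i.rev`. -/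
theorem reflect_failurePoly {n : ℕ} (r : Fin n → ℝ) :
    (failurePoly r).reflect n = failurePoly fun i => 1 - r i.rev := by
  have hrefl : ∀ {n : ℕ} (r : Fin n → ℝ),
      (failurePoly r).reflect n = failurePoly fun i => 1 - r i := by
    intro n
    induction n with
    | zero => intro r; simp [failurePoly]
    | succ n ih =>
      intro r
      have e : (C (1 - r 0) * X + C (r 0)).reflect 1 = C (1 - (1 - r 0)) * X + C (1 - r 0) := by
        rw [reflect_add, reflect_C_mul, reflect_C]
        simp [add_comm]
      have := reflect_mul (C (1 - r 0) * X + C (r 0)) (failurePoly fun i => r i.succ)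
        (F := 1) (G := n) natDegree_linear_le (natDegree_failurePoly_le _)
      rw [ih, e, add_comm 1 n] at this
      simpa only [failurePoly, Fin.prod_univ_succ] using this
  rw [hrefl]
  exact (Equiv.prod_comp Fin.revPerm fun i => C (1 - (1 - r i)) * X + C (1 - r i)).symm

/-- The expansion of `∏ (m + rᵢ)` in the basis `m ^ j * (m + 1) ^ (n - j)`. -/
theorem prod_add_eq_sum_failurePoly {n : ℕ} (r : Fin n → ℝ) (m : ℕ) :
    ∏ i, ((m : ℝ) + r i) = ∑ j ∈ Finset.range (n + 1),
      (failurePoly r).coeff j * ((m : ℝ) ^ j * ((m : ℝ) + 1) ^ (n - j)) := by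
  have hm : (m : ℝ) + 1 ≠ 0 := by positivity
  have h1 : (failurePoly r).eval ((m : ℝ) / (m + 1)) * ((m : ℝ) + 1) ^ n
      = ∏ i, ((m : ℝ) + r i) := by
    have : ((m : ℝ) + 1) ^ n = ∏ _i : Fin n, ((m : ℝ) + 1) := by simp
    rw [this, failurePoly, eval_prod, ← Finset.prod_mul_distrib]
    refine Finset.prod_congr rfl fun i _ => ?_
    simp only [eval_add, eval_mul, eval_C, eval_X]
    field_simp
    ring
  rw [← h1, eval_eq_sum_range' (Nat.lt_succ_of_le (natDegree_failurePoly_le r)), Finset.sum_mul]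
  refine Finset.sum_congr rfl fun j hj => ?_
  obtain ⟨i, rfl⟩ : ∃ i, n = j + i := ⟨n - j, by
    have := Finset.mem_range.1 hj; omega⟩
  rw [Nat.add_sub_cancel_left, div_pow, pow_add]
  field_simp

theorem IsHPolynomial.eq_sum_eulerRefined {n : ℕ} {r : Fin n → ℝ} {h : ℝ[X]}
    (hh : IsHPolynomial n (∏ i, (X + C (r i))) h) :
    h = ∑ j ∈ Finset.range (n + 1), C ((failurePoly r).coeff j) * eulerRefined n j := by
  apply Polynomial.coe_injective ℝ
  have h1 : (PowerSeries.mk fun m : ℕ => (∏ i, (X + C (r i))).eval (m : ℝ))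
      = ∑ j ∈ Finset.range (n + 1), PowerSeries.C ((failurePoly r).coeff j)
        * PowerSeries.mk fun m : ℕ => (m : ℝ) ^ j * ((m : ℝ) + 1) ^ (n - j) := by
    ext m
    simp [eval_prod, prod_add_eq_sum_failurePoly, map_sum]
  rw [← hh.2, h1, Finset.sum_mul]
  have h2 := map_sum (coeToPowerSeries.ringHom (R := ℝ))
    (fun j => C ((failurePoly r).coeff j) * eulerRefined n j) (Finset.range (n + 1))
  refine Eq.trans ?_ h2.symm
  refine Finset.sum_congr rfl fun j hj => ?_
  rw [mul_assoc, eulerRefined_genFun n j (Nat.lt_succ_iff.1 (Finset.mem_range.1 hj))]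
  simp

/-- The weights are `P j = ∑' k, c k * w k j`. The likelihood inequality is bilinear in the weight
sequences, so it passes to the sum once it holds for every pair `k`, `l`. -/
theorem exists_eq_sum_eulerRefined {n : ℕ} {r : ℕ+ → Fin n → ℝ} {h : ℕ+ → ℝ[X]} {c : ℕ+ → ℝ}
    {p : ℝ[X]} (hr_mem : ∀ k i, r k i ∈ Set.Icc (0 : ℝ) 1)
    (hh : ∀ k, IsHPolynomial n (∏ i, (X + C (r k i))) (h k)) (hc : ∀ k, 0 ≤ c k)
    (hp : ∀ j : ℕ, HasSum (fun k => c k * (h k).coeff j) (p.coeff j))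
    (hsum : ∀ (k l : ℕ+) (i : Fin n), r k i + r l i.rev ∈ Set.Icc (0 : ℝ) 1) :
    ∃ P : ℕ → ℝ, (∀ j, 0 ≤ P j) ∧
      p = ∑ j ∈ Finset.range (n + 1), C (P j) * eulerRefined n j ∧
      ∀ k j, k ≤ j → j ≤ n → P k * P (n - j) ≤ P j * P (n - k) := by
  set w : ℕ+ → ℕ → ℝ := fun k j => (failurePoly (r k)).coeff j with hw
  have hw0 : ∀ k j, 0 ≤ w k j := fun k j =>
    coeff_failurePoly_nonneg (fun i => (hr_mem k i).1) (fun i => (hr_mem k i).2) j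
  have hhw : ∀ k, h k = ∑ j ∈ Finset.range (n + 1), C (w k j) * eulerRefined n j := fun k =>
    (hh k).eq_sum_eulerRefined
  have hdeg : ∀ k, (h k).natDegree ≤ n := fun k => by
    rw [hhw k]
    exact natDegree_sum_le_of_forall_le _ _ fun j _ =>
      (natDegree_C_mul_le _ _).trans (natDegree_eulerRefined_le n j)
  have hsummable : ∀ j, Summable fun k => c k * w k j := by
    intro j
    rcases Nat.lt_or_ge n j with hj | hj
    · have : ∀ k, w k j = 0 := fun k =>
        coeff_eq_zero_of_natDegree_lt ((natDegree_failurePoly_le _).trans_lt hj)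
      simp [this, summable_zero]
    -- Convergence is known only for the coefficients of `c k * h k`; the value at `1` is a finite
    -- sum of these and dominates each `w k j` up to a positive constant.
    have hpos := eval_one_eulerRefined_pos n j hj
    have h1 : Summable fun k => ((h k).eval 1 * c k) / (eulerRefined n j).eval 1 := by
      refine Summable.div_const ?_ _
      have : ∀ k, (h k).eval 1 * c k = ∑ i ∈ Finset.range (n + 1), c k * (h k).coeff i := by
        intro k
        rw [eval_eq_sum_range' (Nat.lt_succ_of_le (hdeg k)), Finset.sum_mul]
        exact Finset.sum_congr rfl fun i _ => by ring
      simp only [this]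
      exact summable_sum fun i _ => (hp i).summable
    refine Summable.of_nonneg_of_le (fun k => mul_nonneg (hc k) (hw0 k j)) (fun k => ?_) h1
    rw [le_div_iff₀ hpos, mul_assoc, mul_comm]
    refine mul_le_mul_of_nonneg_right ?_ (hc k)
    rw [hhw k, eval_finsetSum]
    simp only [eval_mul, eval_C]
    exact Finset.single_le_sum (f := fun j => w k j * (eulerRefined n j).eval 1)
      (fun i hi => mul_nonneg (hw0 k i)
        (eval_one_eulerRefined_pos n i (Nat.lt_succ_iff.1 (Finset.mem_range.1 hi))).le)
      (Finset.mem_range.2 (Nat.lt_succ_of_le hj))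
  have hlr : ∀ k l i j, i ≤ j → j ≤ n → w k i * w l (n - j) ≤ w k j * w l (n - i) := by
    intro k l i j hij hj
    have hrev : ∀ i ≤ n, (failurePoly fun i => 1 - r l i.rev).coeff i = w l (n - i) := by
      intro i hi
      rw [← reflect_failurePoly, coeff_reflect, revAt_le hi]
    have := likelihoodLE_failurePoly (r := r k) (r' := fun i => 1 - r l i.rev)
      (fun i => (hr_mem k i).1) (fun i => by have := (hsum k l i).2; linarith)
      (fun i => by have := (hr_mem l i.rev).1; linarith) i j j i le_rfl (by exact_mod_cast hij)
      (by exact_mod_cast hij) le_rfl (by ring)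
    simp only [intCoeff_natCast] at this
    rw [hrev _ hj, hrev _ (hij.trans hj)] at this
    linarith
  refine ⟨fun j => ∑' k, c k * w k j, fun j => tsum_nonneg fun k => mul_nonneg (hc k) (hw0 k j),
    ?_, ?_⟩
  · ext i
    refine (hp i).unique ?_
    simp only [finsetSum_coeff, coeff_C_mul]
    have : ∀ k, c k * (h k).coeff i
        = ∑ j ∈ Finset.range (n + 1), c k * w k j * (eulerRefined n j).coeff i := by
      intro k
      rw [hhw k, finsetSum_coeff, Finset.mul_sum]
      exact Finset.sum_congr rfl fun j _ => by rw [coeff_C_mul, mul_assoc]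
    simp only [this]
    exact hasSum_sum fun j _ => (hsummable j).hasSum.mul_right _
  · intro i j hij hj
    simp only
    rw [← tsum_mul_right, ← tsum_mul_right]
    refine Summable.tsum_le_tsum (fun k => ?_) ((hsummable i).mul_right _)
      ((hsummable j).mul_right _)
    rw [← tsum_mul_left, ← tsum_mul_left]
    refine Summable.tsum_le_tsum (fun l => ?_) ((hsummable _).mul_left _)
      ((hsummable _).mul_left _)
    have := mul_le_mul_of_nonneg_left (hlr k l i j hij hj) (mul_nonneg (hc k) (hc l))
    linarith

/-! ### Symmetric unimodal and alternatingly increasing polynomials -/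

/-- `q` is symmetric with respect to `m` and its coefficients are nonnegative and unimodal. -/
structure IsSymmUnimodal (m : ℕ) (q : ℝ[X]) : Prop where
  natDegree_le : q.natDegree ≤ m
  symm : q.reflect m = q
  coeff_zero_nonneg : 0 ≤ q.coeff 0
  coeff_le : ∀ i, 2 * i + 2 ≤ m → q.coeff i ≤ q.coeff (i + 1)

theorem IsSymmUnimodal.coeff_sub {m : ℕ} {q : ℝ[X]} (h : IsSymmUnimodal m q) {i : ℕ}
    (hi : i ≤ m) : q.coeff (m - i) = q.coeff i := by
  conv_rhs => rw [← h.symm, coeff_reflect, revAt_le hi]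

theorem IsSymmUnimodal.zero (m : ℕ) : IsSymmUnimodal m 0 :=
  ⟨by simp, by simp, by simp, by simp⟩

theorem IsSymmUnimodal.add {m : ℕ} {p q : ℝ[X]} (hp : IsSymmUnimodal m p)
    (hq : IsSymmUnimodal m q) : IsSymmUnimodal m (p + q) where
  natDegree_le := natDegree_add_le_of_degree_le hp.natDegree_le hq.natDegree_le
  symm := by rw [reflect_add, hp.symm, hq.symm]
  coeff_zero_nonneg := by
    rw [coeff_add]
    exact add_nonneg hp.coeff_zero_nonneg hq.coeff_zero_nonneg
  coeff_le i hi := by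
    rw [coeff_add, coeff_add]
    exact add_le_add (hp.coeff_le i hi) (hq.coeff_le i hi)

theorem IsSymmUnimodal.C_mul {m : ℕ} {q : ℝ[X]} (hq : IsSymmUnimodal m q) {c : ℝ} (hc : 0 ≤ c) :
    IsSymmUnimodal m (C c * q) where
  natDegree_le := (natDegree_C_mul_le _ _).trans hq.natDegree_le
  symm := by rw [reflect_C_mul, hq.symm]
  coeff_zero_nonneg := by
    rw [coeff_C_mul]
    exact mul_nonneg hc hq.coeff_zero_nonneg
  coeff_le i hi := by
    rw [coeff_C_mul, coeff_C_mul]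
    exact mul_le_mul_of_nonneg_left (hq.coeff_le i hi) hc

theorem IsSymmUnimodal.sum {ι : Type*} {m : ℕ} {s : Finset ι} {q : ι → ℝ[X]}
    (h : ∀ i ∈ s, IsSymmUnimodal m (q i)) : IsSymmUnimodal m (∑ i ∈ s, q i) :=
  Finset.sum_induction q (IsSymmUnimodal m) (fun _ _ => IsSymmUnimodal.add) (.zero m) h

theorem AlternatinglyIncreasing.add {n : ℕ} {p q : ℝ[X]} (hp : AlternatinglyIncreasing n p)
    (hq : AlternatinglyIncreasing n q) : AlternatinglyIncreasing n (p + q) := by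
  refine ⟨(degree_add_le _ _).trans (max_le hp.1 hq.1), ?_, fun i hi => ?_, fun i hi => ?_⟩ <;>
    simp only [coeff_add]
  · exact add_nonneg hp.2.1 hq.2.1
  · exact add_le_add (hp.2.2.1 i hi) (hq.2.2.1 i hi)
  · exact add_le_add (hp.2.2.2 i hi) (hq.2.2.2 i hi)

theorem AlternatinglyIncreasing.C_mul {n : ℕ} {q : ℝ[X]} (hq : AlternatinglyIncreasing n q)
    {c : ℝ} (hc : 0 ≤ c) : AlternatinglyIncreasing n (C c * q) := by
  refine ⟨natDegree_le_iff_degree_le.1 ((natDegree_C_mul_le _ _).trans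
    (natDegree_le_iff_degree_le.2 hq.1)), ?_, fun i hi => ?_, fun i hi => ?_⟩ <;>
    simp only [coeff_C_mul]
  · exact mul_nonneg hc hq.2.1
  · exact mul_le_mul_of_nonneg_left (hq.2.2.1 i hi) hc
  · exact mul_le_mul_of_nonneg_left (hq.2.2.2 i hi) hc

theorem AlternatinglyIncreasing.sum {ι : Type*} {n : ℕ} {s : Finset ι} {q : ι → ℝ[X]}
    (h : ∀ i ∈ s, AlternatinglyIncreasing n (q i)) :
    AlternatinglyIncreasing n (∑ i ∈ s, q i) :=
  Finset.sum_induction q (AlternatinglyIncreasing n) (fun _ _ => .add)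
    ⟨by simp, by simp, by simp, by simp⟩ h

theorem IsSymmUnimodal.alternatinglyIncreasing {m : ℕ} {q : ℝ[X]} (h : IsSymmUnimodal m q) :
    AlternatinglyIncreasing m q := by
  refine ⟨natDegree_le_iff_degree_le.1 h.natDegree_le, h.coeff_zero_nonneg, fun i hi => ?_,
    fun i hi => ?_⟩ <;> rw [h.coeff_sub (by omega)]
  exact h.coeff_le i hi

theorem AlternatinglyIncreasing.isSymmUnimodal_add_reflect {m : ℕ} {q : ℝ[X]}
    (h : AlternatinglyIncreasing m q) : IsSymmUnimodal m (q + q.reflect m) := by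
  obtain ⟨hdeg, h0, h1, h2⟩ := h
  have hdeg' := natDegree_le_iff_degree_le.2 hdeg
  refine ⟨natDegree_add_le_of_degree_le hdeg' (natDegree_reflect_le' hdeg'), ?_, ?_,
    fun i hi => ?_⟩
  · rw [reflect_add, reflect_reflect, add_comm]
  · rw [coeff_add, coeff_reflect, revAt_le (Nat.zero_le m)]
    rcases Nat.eq_zero_or_pos m with rfl | hm
    · simpa using h0
    · have := h1 0 (by omega)
      linarith
  · rw [coeff_add, coeff_add, coeff_reflect, coeff_reflect, revAt_le (by omega),
      revAt_le (by omega)]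
    have e1 := h1 i (by omega)
    have e2 := h2 i hi
    rcases Nat.eq_or_lt_of_le hi with he | hlt
    · rw [show m - (i + 1) = i + 1 by omega]
      linarith
    · have e3 := h1 (i + 1) (by omega)
      linarith

theorem AlternatinglyIncreasing.isSymmUnimodal_add_X_mul_reflect {m : ℕ} {q : ℝ[X]}
    (h : AlternatinglyIncreasing m q) : IsSymmUnimodal (m + 1) (q + X * q.reflect m) := by
  obtain ⟨hdeg, h0, h1, h2⟩ := h
  have hdeg' := natDegree_le_iff_degree_le.2 hdeg
  refine ⟨natDegree_add_le_of_degree_le (hdeg'.trans m.le_succ) ?_, ?_, ?_, fun i hi => ?_⟩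
  · rw [add_comm m]
    exact natDegree_mul_le_of_le natDegree_X_le (natDegree_reflect_le' hdeg')
  · rw [reflect_add, reflect_succ_X_mul (natDegree_reflect_le' hdeg'), reflect_reflect,
      reflect_succ hdeg', add_comm]
  · simpa using h0
  · rw [coeff_add, coeff_add, coeff_X_mul, coeff_reflect, revAt_le (by omega)]
    have e1 := h1 i (by omega)
    cases i with
    | zero =>
      simp only [mul_coeff_zero, coeff_X_zero, zero_mul, add_zero, zero_add, Nat.sub_zero] at *
      rcases Nat.eq_or_lt_of_le (show 1 ≤ m by omega) with rfl | hlt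
      · linarith
      · have e2 := h2 0 (by omega)
        simp only [zero_add, Nat.sub_zero] at e2
        linarith
    | succ t =>
      rw [coeff_X_mul, coeff_reflect, revAt_le (by omega)]
      have e2 := h2 t (by omega)
      have e3 := h1 (t + 1) (by omega)
      rcases Nat.lt_or_ge m (2 * t + 4) with hlt | hge
      · rw [show m - (t + 1) = t + 1 + 1 by omega] at *
        linarith
      · have e4 := h2 (t + 1) (by omega)
        linarith

/-- By symmetry `a` cancels when the coefficients `i` and `m + 1 - i` are compared, and `b` cancels
for `m + 1 - i` and `i + 1`; what remains is unimodality of the other part. -/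
theorem alternatinglyIncreasing_add_X_mul {m : ℕ} {a b : ℝ[X]} (ha : IsSymmUnimodal (m + 1) a)
    (hb : IsSymmUnimodal m b) : AlternatinglyIncreasing (m + 1) (a + X * b) := by
  refine ⟨natDegree_le_iff_degree_le.1 (natDegree_add_le_of_degree_le ha.natDegree_le ?_),
    by simpa using ha.coeff_zero_nonneg, fun i hi => ?_, fun i hi => ?_⟩
  · rw [add_comm m]
    exact natDegree_mul_le_of_le natDegree_X_le hb.natDegree_le
  · rw [coeff_add, coeff_add, ha.coeff_sub (by omega), show m + 1 - i = m - i + 1 by omega,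
      coeff_X_mul, hb.coeff_sub (by omega)]
    cases i with
    | zero => simpa using hb.coeff_zero_nonneg
    | succ t =>
      rw [coeff_X_mul]
      exact add_le_add_right (hb.coeff_le t (by omega)) _
  · rw [coeff_add, coeff_add, ha.coeff_sub (by omega), show m + 1 - i = m - i + 1 by omega,
      coeff_X_mul, coeff_X_mul, hb.coeff_sub (by omega)]
    exact add_le_add_left (ha.coeff_le i hi) _

/-- In the recurrence the terms `k < n + 1 - j` are the reflections of the terms `k ≥ j`; together
they form the symmetric part `a`. The middle block `n + 1 - j ≤ k < j` is closed under reflection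
and forms `b`. -/
theorem alternatinglyIncreasing_eulerRefined (n : ℕ) : ∀ j ≤ n, n ≤ 2 * j →
    AlternatinglyIncreasing n (eulerRefined n j) := by
  induction n with
  | zero =>
    intro j _ _
    rw [eulerRefined_zero]
    exact ⟨by simp, by simp, by simp, by simp⟩
  | succ n ih =>
    intro j hj hnj
    have hsymm : ∀ k ≤ n, IsSymmUnimodal n (eulerRefined n k + (eulerRefined n k).reflect n) := by
      intro k hk
      rcases le_total n (2 * k) with h | h
      · exact (ih k hk h).isSymmUnimodal_add_reflect
      · have := (ih (n - k) (by omega) (by omega)).isSymmUnimodal_add_reflect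
        rwa [← reflect_eulerRefined n k hk, reflect_reflect, add_comm] at this
    have hrefl : ∀ i l, l ≤ n + 1 → ∑ k ∈ Finset.Ico i l, (eulerRefined n k).reflect n
        = ∑ k ∈ Finset.Ico (n + 1 - l) (n + 1 - i), eulerRefined n k := by
      intro i l hl
      rw [← sum_Ico_reflect' _ hl]
      exact Finset.sum_congr rfl fun k hk => reflect_eulerRefined n k (by simp at hk; omega)
    have hb : IsSymmUnimodal n (∑ k ∈ Finset.Ico (n + 1 - j) j, eulerRefined n k) := by
      have h1 : ∑ k ∈ Finset.Ico (n + 1 - j) j, eulerRefined n k = C (1 / 2 : ℝ)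
          * ∑ k ∈ Finset.Ico (n + 1 - j) j,
            (eulerRefined n k + (eulerRefined n k).reflect n) := by
        rw [Finset.sum_add_distrib, hrefl _ _ hj, show n + 1 - (n + 1 - j) = j by omega,
          ← two_mul, ← mul_assoc, ← C_ofNat, ← C_mul]
        norm_num
      rw [h1]
      exact (IsSymmUnimodal.sum fun k hk => hsymm k (by simp at hk; omega)).C_mul (by norm_num)
    have ha : IsSymmUnimodal (n + 1) (∑ k ∈ Finset.Ico j (n + 1),
        (eulerRefined n k + X * (eulerRefined n k).reflect n)) :=
      IsSymmUnimodal.sum fun k hk => by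
        have := Finset.mem_Ico.1 hk
        exact (ih k (by omega) (by omega)).isSymmUnimodal_add_X_mul_reflect
    convert alternatinglyIncreasing_add_X_mul ha hb using 1
    rw [eulerRefined_succ, Finset.sum_add_distrib, ← Finset.mul_sum, hrefl _ _ le_rfl,
      ← Finset.sum_range_add_sum_Ico (eulerRefined n) (show n + 1 - j ≤ j by omega),
      Nat.sub_self, Finset.range_eq_Ico]
    ring

/-- For `n ≤ 2 * j` the indices `j` and `n - j` together contribute `(P j - P (n - j)) E j + P (n -
j) (E j + reflect (E j))`, with nonnegative coefficients. -/
theorem alternatinglyIncreasing_sum_eulerRefined {n : ℕ} {P : ℕ → ℝ} (hP : ∀ j, 0 ≤ P j)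
    (hPn : ∀ j, 2 * j ≤ n → P j ≤ P (n - j)) :
    AlternatinglyIncreasing n (∑ j ∈ Finset.range (n + 1), C (P j) * eulerRefined n j) := by
  have h1 : ∑ j ∈ Finset.range (n + 1), C (P j) * eulerRefined n j
      = C (1 / 2 : ℝ) * ∑ j ∈ Finset.range (n + 1),
        (C (P j) * eulerRefined n j + C (P (n - j)) * eulerRefined n (n - j)) := by
    rw [Finset.sum_add_distrib, Finset.sum_flip fun j => C (P j) * eulerRefined n j, ← two_mul,
      ← mul_assoc, ← C_ofNat, ← C_mul]
    norm_num
  have key : ∀ j ≤ n, n ≤ 2 * j → AlternatinglyIncreasing n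
      (C (P j) * eulerRefined n j + C (P (n - j)) * eulerRefined n (n - j)) := by
    intro j hj hnj
    have h2 := alternatinglyIncreasing_eulerRefined n j hj hnj
    have h3 := hPn (n - j) (by omega)
    rw [Nat.sub_sub_self hj] at h3
    convert (h2.C_mul (sub_nonneg.2 h3)).add
      (h2.isSymmUnimodal_add_reflect.alternatinglyIncreasing.C_mul (hP (n - j))) using 1
    rw [reflect_eulerRefined n j hj, C_sub]
    ring
  rw [h1]
  refine AlternatinglyIncreasing.C_mul (.sum fun j hj => ?_) (by norm_num)
  have hj : j ≤ n := Nat.lt_succ_iff.1 (Finset.mem_range.1 hj)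
  rcases le_total n (2 * j) with h | h
  · exact key j hj h
  · have := key (n - j) (by omega) (by omega)
    rwa [Nat.sub_sub_self hj, add_comm] at this

/-! ### The two interlacing relations -/

theorem aeval_sum_C_mul {ι : Type*} (s : Finset ι) (P : ι → ℝ) (f : ι → ℝ[X]) (z : ℂ) :
    aeval z (∑ j ∈ s, C (P j) * f j) = ∑ j ∈ s, (P j : ℂ) * aeval z (f j) := by
  simp [map_sum]

theorem reflect_sum_eulerRefined (n : ℕ) (P : ℕ → ℝ) :
    (∑ j ∈ Finset.range (n + 1), C (P j) * eulerRefined n j).reflect n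
      = ∑ j ∈ Finset.range (n + 1), C (P (n - j)) * eulerRefined n j := by
  rw [reflect_sum, ← Finset.sum_flip fun j => C (P (n - j)) * eulerRefined n j]
  refine Finset.sum_congr rfl fun j hj => ?_
  have hj : j ≤ n := Nat.lt_succ_iff.1 (Finset.mem_range.1 hj)
  rw [reflect_C_mul, reflect_eulerRefined n j hj, Nat.sub_sub_self hj]

theorem natDegree_sum_eulerRefined_le (n : ℕ) (P : ℕ → ℝ) :
    (∑ j ∈ Finset.range (n + 1), C (P j) * eulerRefined n j).natDegree ≤ n :=
  natDegree_sum_le_of_forall_le _ _ fun j _ =>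
    (natDegree_C_mul_le _ _).trans (natDegree_eulerRefined_le n j)

theorem exists_ne_zero_of_sum_eulerRefined_ne_zero {n : ℕ} {P : ℕ → ℝ}
    (h : ∑ j ∈ Finset.range (n + 1), C (P j) * eulerRefined n j ≠ 0) : ∃ j ≤ n, P j ≠ 0 := by
  obtain ⟨j, hj, hne⟩ := Finset.exists_ne_zero_of_sum_ne_zero h
  exact ⟨j, Nat.lt_succ_iff.1 (Finset.mem_range.1 hj), fun h0 => hne (by simp [h0])⟩

theorem aeval_sum_eulerRefined_ne_zero {n : ℕ} {P : ℕ → ℝ} (hP : ∀ j, 0 ≤ P j)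
    (h : ∑ j ∈ Finset.range (n + 1), C (P j) * eulerRefined n j ≠ 0) {z : ℂ} (hz : 0 < z.im) :
    aeval z (∑ j ∈ Finset.range (n + 1), C (P j) * eulerRefined n j) ≠ 0 := by
  rw [aeval_sum_C_mul]
  exact (argChain_eulerRefined hz n).sum_ne_zero (fun j _ => hP j)
    (exists_ne_zero_of_sum_eulerRefined_ne_zero h)

theorem LL_reflect_sum_eulerRefined {n : ℕ} {P : ℕ → ℝ} (hP : ∀ j, 0 ≤ P j)
    (hPP : ∀ k j, k ≤ j → j ≤ n → P k * P (n - j) ≤ P j * P (n - k))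
    (h : ∑ j ∈ Finset.range (n + 1), C (P j) * eulerRefined n j ≠ 0) :
    LL ((∑ j ∈ Finset.range (n + 1), C (P j) * eulerRefined n j).reflect n)
      (∑ j ∈ Finset.range (n + 1), C (P j) * eulerRefined n j) := by
  have h' : (∑ j ∈ Finset.range (n + 1), C (P j) * eulerRefined n j).reflect n ≠ 0 := by
    rwa [Ne, reflect_eq_zero_iff]
  rw [reflect_sum_eulerRefined] at h' ⊢
  refine LL_of_im_mul_conj_nonneg h h' (fun z hz => aeval_sum_eulerRefined_ne_zero hP h hz)
    (fun z hz => aeval_sum_eulerRefined_ne_zero (P := fun j => P (n - j)) (fun j => hP _) h' hz)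
    fun z hz => ?_
  rw [aeval_sum_C_mul, aeval_sum_C_mul]
  exact (argChain_eulerRefined hz n).im_sum_mul_conj_sum_nonneg (V := fun j => P (n - j)) hPP

/-- The likelihood ratio order descends to partial sums: the product of the initial blocks cancels,
and the rest compares termwise for `k ≤ j < l`. -/
theorem sum_range_mul_sum_range_le {n : ℕ} {P R : ℕ → ℝ}
    (h : ∀ k j, k ≤ j → j ≤ n → P k * R j ≤ P j * R k) {j i : ℕ} (hji : j ≤ i) (hi : i ≤ n) :
    (∑ k ∈ Finset.range (j + 1), P k) * ∑ k ∈ Finset.range (i + 1), R k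
      ≤ (∑ k ∈ Finset.range (i + 1), P k) * ∑ k ∈ Finset.range (j + 1), R k := by
  rw [← Finset.sum_range_add_sum_Ico P (Nat.succ_le_succ hji),
    ← Finset.sum_range_add_sum_Ico R (Nat.succ_le_succ hji), mul_add, add_mul]
  refine add_le_add_right ?_ _
  rw [mul_comm (∑ k ∈ Finset.Ico _ _, P k), Finset.sum_mul_sum, Finset.sum_mul_sum]
  refine Finset.sum_le_sum fun k hk => Finset.sum_le_sum fun l hl => ?_
  have h1 := Finset.mem_range.1 hk
  have h2 := Finset.mem_Ico.1 hl
  have := h k l (by omega) (by omega)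
  linarith

open ComplexConjugate in
theorem ArgChain.sum_mem_cone {z : ℂ} {n : ℕ} {f : ℕ → ℂ} (h : ArgChain z n f) {P : ℕ → ℝ}
    (hP : ∀ j ≤ n, 0 ≤ P j) :
    0 ≤ ((∑ j ∈ Finset.range (n + 1), (P j : ℂ) * f j) * conj (f 0)).im ∧
      0 ≤ (z * f 0 * conj (∑ j ∈ Finset.range (n + 1), (P j : ℂ) * f j)).im := by
  rw [map_sum, Finset.sum_mul, Finset.mul_sum, Complex.im_sum, Complex.im_sum]
  constructor <;> refine Finset.sum_nonneg fun j hj => ?_ <;>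
    have hj : j ≤ n := Nat.lt_succ_iff.1 (Finset.mem_range.1 hj)
  · rw [mul_assoc, Complex.im_ofReal_mul]
    exact mul_nonneg (hP j hj) (h.le 0 j (Nat.zero_le _) hj)
  · rw [map_mul, Complex.conj_ofReal, mul_left_comm, Complex.im_ofReal_mul]
    exact mul_nonneg (hP j hj) (h.le_mul 0 j (Nat.zero_le _) hj)

open ComplexConjugate in
-- At `z` write `a = A + z U` and `b = W`. The order of `T` and `β` puts `A` left of `W`. Reversed,
-- using the symmetry of `β`, it puts `W` left of `U`, and the cone lemma then puts `z U` left of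
-- `W`.
theorem LL_of_cumulative {m : ℕ} {T β : ℕ → ℝ} (hT : ∀ i, 0 ≤ T i) (hTm : Monotone T)
    (hβ : ∀ i ≤ m, 0 ≤ β i) (hβs : ∀ i ≤ m, β (m - i) = β i)
    (hTβ : ∀ j i, j ≤ i → i ≤ m → T j * β i ≤ T i * β j)
    (ha : ∑ k ∈ Finset.range (m + 1), C (T k) * eulerRefined m k
      + X * ∑ k ∈ Finset.range (m + 1), C (T (m - k)) * eulerRefined m k ≠ 0)
    (hb : ∑ k ∈ Finset.range (m + 1), C (β k) * eulerRefined m k ≠ 0) :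
    LL (∑ k ∈ Finset.range (m + 1), C (β k) * eulerRefined m k)
      (∑ k ∈ Finset.range (m + 1), C (T k) * eulerRefined m k
        + X * ∑ k ∈ Finset.range (m + 1), C (T (m - k)) * eulerRefined m k) := by
  refine LL_of_im_mul_conj_nonneg ha hb (fun z hz h0 => ha ?_) (fun z hz => ?_) fun z hz => ?_
  · have hchain := argChain_eulerRefined hz m
    rw [map_add, map_mul, aeval_X, aeval_sum_C_mul, aeval_sum_C_mul] at h0
    -- Monotonicity of `T` puts `A` left of `U`, whereas `A = -z U` would give the imaginary part
    -- `-Im z * |U|²`. Hence `U = 0`, so all `T k` with `k ≤ m` vanish and `a = 0`.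
    have h1 := hchain.im_sum_mul_conj_sum_nonneg (U := T) (V := fun k => T (m - k))
      fun k j hkj hj => mul_le_mul (hTm hkj) (hTm (by omega)) (hT _) (hT _)
    rw [eq_neg_of_add_eq_zero_left h0, neg_mul, Complex.neg_im, im_mul_mul_conj_self] at h1
    have hU : ∑ k ∈ Finset.range (m + 1), (T (m - k) : ℂ) * aeval z (eulerRefined m k) = 0 := by
      by_contra hne
      have := mul_pos hz (Complex.normSq_pos.2 hne)
      linarith
    have hT0 : ∀ k ≤ m, T (m - k) = 0 := by
      by_contra! hne
      exact hchain.sum_ne_zero (P := fun k => T (m - k)) (fun k _ => hT _) hne hU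
    have hT0' : ∀ k ≤ m, T k = 0 := fun k hk => by
      have := hT0 (m - k) (by omega)
      rwa [Nat.sub_sub_self hk] at this
    rw [Finset.sum_eq_zero fun k hk => ?_, Finset.sum_eq_zero fun k hk => ?_, mul_zero, add_zero]
    · rw [hT0 k (Nat.lt_succ_iff.1 (Finset.mem_range.1 hk)), C_0, zero_mul]
    · rw [hT0' k (Nat.lt_succ_iff.1 (Finset.mem_range.1 hk)), C_0, zero_mul]
  · rw [aeval_sum_C_mul]
    exact (argChain_eulerRefined hz m).sum_ne_zero hβ
      (exists_ne_zero_of_sum_eulerRefined_ne_zero hb)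
  · have hchain := argChain_eulerRefined hz m
    rw [map_add, map_mul, aeval_X, aeval_sum_C_mul, aeval_sum_C_mul, aeval_sum_C_mul, add_mul,
      Complex.add_im]
    refine add_nonneg (hchain.im_sum_mul_conj_sum_nonneg hTβ) ?_
    have hU := hchain.sum_mem_cone (P := fun k => T (m - k)) fun k _ => hT _
    have hW := hchain.sum_mem_cone hβ
    refine im_mul_mul_conj_nonneg_of_mem_cone hz (hchain.ne_zero 0 (Nat.zero_le _)) hU.1 hU.2
      hW.1 hW.2 (hchain.im_sum_mul_conj_sum_nonneg fun k j hkj hj => ?_)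
    have := hTβ (m - j) (m - k) (by omega) (by omega)
    rw [hβs k (by omega), hβs j hj] at this
    linarith

theorem LL_symmDecomp_sum_eulerRefined {n : ℕ} {P : ℕ → ℝ} {a b : ℝ[X]} (hP : ∀ j, 0 ≤ P j)
    (hPP : ∀ k j, k ≤ j → j ≤ n → P k * P (n - j) ≤ P j * P (n - k))
    (hPn : ∀ j, 2 * j ≤ n → P j ≤ P (n - j))
    (h : ∑ j ∈ Finset.range (n + 1), C (P j) * eulerRefined n j ≠ 0)
    (hab : IsSymmDecomp n (∑ j ∈ Finset.range (n + 1), C (P j) * eulerRefined n j) a b) :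
    LL b a := by
  have hp_splits := splits_of_aeval_ne_zero fun z hz => aeval_sum_eulerRefined_ne_zero hP h hz
  have hdeg := natDegree_le_iff_degree_le.1 (natDegree_sum_eulerRefined_le n P)
  -- In the degenerate cases `p = a` or `p = X * b`, and the other part inherits real-rootedness
  -- from `p`.
  rcases eq_or_ne b 0 with rfl | hb
  · have := hab.eq
    rw [mul_zero, add_zero] at this
    exact Or.inr (Or.inr (Or.inl ⟨rfl, this ▸ hp_splits⟩))
  rcases eq_or_ne a 0 with rfl | ha
  · have := hab.eq
    rw [zero_add] at this
    rw [this, splits_X_mul] at hp_splits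
    exact Or.inr (Or.inr (Or.inr ⟨rfl, hp_splits⟩))
  cases n with
  | zero =>
    have := hab.deg_b
    exact absurd this (not_lt.2 (zero_le_degree_iff.2 hb))
  | succ m =>
    -- Exchanging sums in the recurrence, `eulerRefined m k` occurs with weight `T k` without `X`,
    -- and with weight `S (m - k) = T (m - k) + β k` with `X`. Splitting off `β` leaves a symmetric
    -- polynomial, so uniqueness identifies `a` and `b`.
    set T : ℕ → ℝ := fun i => ∑ j ∈ Finset.range (i + 1), P j with hTdef
    set S : ℕ → ℝ := fun i => ∑ j ∈ Finset.range (i + 1), P (m + 1 - j) with hSdef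
    set β : ℕ → ℝ := fun i => S i - T i with hβdef
    have hS : ∀ k ≤ m, S (m - k) = ∑ j ∈ Finset.Ico (k + 1) (m + 2), P j := by
      intro k hk
      simp only [hSdef]
      rw [Finset.range_eq_Ico, Finset.sum_Ico_reflect P 0 (by omega)]
      congr 2
      omega
    have hST : ∀ k ≤ m, S (m - k) = (∑ j ∈ Finset.range (m + 2), P j) - T k := by
      intro k hk
      rw [hS k hk, ← Finset.sum_range_add_sum_Ico P (show k + 1 ≤ m + 2 by omega)]
      ring
    have hβs : ∀ k ≤ m, β (m - k) = β k := by
      intro k hk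
      have h1 := hST k hk
      have h2 := hST (m - k) (by omega)
      rw [Nat.sub_sub_self hk] at h2
      simp only [hβdef]
      linarith
    have hβ : ∀ k ≤ m, 0 ≤ β k := by
      have h1 : ∀ k, 2 * k ≤ m → 0 ≤ β k := fun k hk =>
        sub_nonneg.2 (Finset.sum_le_sum fun j hj => hPn j (by
          have := Finset.mem_range.1 hj; omega))
      intro k hk
      rcases Nat.lt_or_ge m (2 * k) with hlt | hge
      · rw [← hβs k hk]
        exact h1 _ (by omega)
      · exact h1 k hge
    have hT : ∀ i, 0 ≤ T i := fun i => Finset.sum_nonneg fun j _ => hP j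
    have hTm : Monotone T := fun i j hij =>
      Finset.sum_le_sum_of_subset_of_nonneg (Finset.range_mono (by omega)) fun k _ _ => hP k
    have hTβ : ∀ j i, j ≤ i → i ≤ m → T j * β i ≤ T i * β j := by
      intro j i hji hi
      have : T j * S i ≤ T i * S j :=
        sum_range_mul_sum_range_le (R := fun j => P (m + 1 - j)) hPP hji (by omega)
      simp only [hβdef]
      linarith
    have hsumdeg : ∀ Q : ℕ → ℝ, (∑ k ∈ Finset.range (m + 1), C (Q k) * eulerRefined m k).natDegree
      ≤ m := natDegree_sum_eulerRefined_le m
    have hTrefl : ∑ k ∈ Finset.range (m + 1), C (T (m - (m - k))) * eulerRefined m k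
        = ∑ k ∈ Finset.range (m + 1), C (T k) * eulerRefined m k :=
      Finset.sum_congr rfl fun k hk => by
        rw [Nat.sub_sub_self (Nat.lt_succ_iff.1 (Finset.mem_range.1 hk))]
    have hdecomp : IsSymmDecomp (m + 1)
        (∑ j ∈ Finset.range (m + 1 + 1), C (P j) * eulerRefined (m + 1) j)
        (∑ k ∈ Finset.range (m + 1), C (T k) * eulerRefined m k
          + X * ∑ k ∈ Finset.range (m + 1), C (T (m - k)) * eulerRefined m k)
        (∑ k ∈ Finset.range (m + 1), C (β k) * eulerRefined m k) := by
      refine ⟨?_, ?_, ?_, ?_, ?_⟩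
      · have h1 : ∑ j ∈ Finset.range (m + 2), ∑ k ∈ Finset.range j, C (P j) * eulerRefined m k
            = ∑ k ∈ Finset.range (m + 1), C (T (m - k) + β k) * eulerRefined m k := by
          rw [Finset.sum_comm' (t' := Finset.range (m + 1))
            (s' := fun k => Finset.Ico (k + 1) (m + 2)) (by
              intro j k; simp only [Finset.mem_range, Finset.mem_Ico]; omega)]
          refine Finset.sum_congr rfl fun k hk => ?_
          have hk : k ≤ m := Nat.lt_succ_iff.1 (Finset.mem_range.1 hk)
          rw [← Finset.sum_mul, ← map_sum, ← hS k hk, ← hβs k hk]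
          simp only [hβdef, add_sub_cancel]
        have h2 : ∑ j ∈ Finset.range (m + 2), ∑ k ∈ Finset.Ico j (m + 1),
              C (P j) * eulerRefined m k
            = ∑ k ∈ Finset.range (m + 1), C (T k) * eulerRefined m k := by
          rw [Finset.sum_comm' (t' := Finset.range (m + 1))
            (s' := fun k => Finset.range (k + 1)) (by
              intro j k; simp only [Finset.mem_range, Finset.mem_Ico]; omega)]
          refine Finset.sum_congr rfl fun k _ => ?_
          rw [← Finset.sum_mul, ← map_sum]
        have h3 : ∀ j, C (P j) * eulerRefined (m + 1) j
            = X * ∑ k ∈ Finset.range j, C (P j) * eulerRefined m k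
              + ∑ k ∈ Finset.Ico j (m + 1), C (P j) * eulerRefined m k := by
          intro j
          rw [eulerRefined_succ, ← Finset.mul_sum, ← Finset.mul_sum]
          ring
        rw [Finset.sum_congr rfl fun j _ => h3 j, Finset.sum_add_distrib, ← Finset.mul_sum]
        rw [h1, h2]
        simp only [C_add, add_mul, Finset.sum_add_distrib]
        ring
      · refine natDegree_le_iff_degree_le.1 (natDegree_add_le_of_degree_le
          ((hsumdeg T).trans m.le_succ) ?_)
        exact (natDegree_mul_le_of_le natDegree_X_le
          (hsumdeg fun k => T (m - k))).trans_eq (add_comm 1 m)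
      · exact (natDegree_le_iff_degree_le.1 (hsumdeg β)).trans_lt (by
          exact_mod_cast Nat.lt_succ_self m)
      · rw [reflect_add, reflect_succ (hsumdeg T), reflect_succ_X_mul
          (hsumdeg fun k => T (m - k)), reflect_sum_eulerRefined,
          reflect_sum_eulerRefined m fun k => T (m - k), hTrefl, add_comm]
      · rw [Nat.add_sub_cancel, reflect_sum_eulerRefined]
        exact Finset.sum_congr rfl fun k hk => by
          rw [hβs k (Nat.lt_succ_iff.1 (Finset.mem_range.1 hk))]
    have huniq := (IsSymmDecomp.existsUnique _ _ hdeg).unique (y₁ := (a, b)) hab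
      (y₂ := (_, _)) hdecomp
    obtain ⟨rfl, rfl⟩ := Prod.mk.inj huniq
    exact LL_of_cumulative hT hTm hβ hβs hTβ ha hb

theorem mainTheorem8 (n : ℕ) (r : ℕ+ → Fin n → ℝ) (h : ℕ+ → ℝ[X]) (c : ℕ+ → ℝ) (p a b : ℝ[X])
    (hr_mono : ∀ k, Monotone (r k))
    (hr_mem : ∀ k i, r k i ∈ Set.Icc (0 : ℝ) 1)
    (hh : ∀ k, IsHPolynomial n (∏ i, (X + C (r k i))) (h k))
    (hc : ∀ k, 0 ≤ c k)
    (hp : ∀ j : ℕ, HasSum (fun k => c k * (h k).coeff j) (p.coeff j))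
    (hdeg : p.degree = n)
    (hab : IsSymmDecomp n p a b)
    (hsum : ∀ (k l : ℕ+) (i : Fin n), r k i + r l i.rev ∈ Set.Icc (0 : ℝ) 1) :
    LL (p.reflect n) p ∧ LL b a ∧ AlternatinglyIncreasing n p := by
  obtain ⟨P, hP, rfl, hPP⟩ := exists_eq_sum_eulerRefined hr_mem hh hc hp hsum
  have hp0 : ∑ j ∈ Finset.range (n + 1), C (P j) * eulerRefined n j ≠ 0 := by
    intro h0
    rw [h0, degree_zero] at hdeg
    exact WithBot.bot_ne_coe hdeg
  have hPn : ∀ j, 2 * j ≤ n → P j ≤ P (n - j) := by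
    intro j hj
    -- On the pair `j ≤ n - j` the inequality compares the squares of `P j` and `P (n - j)`.
    have := hPP j (n - j) (by omega) (by omega)
    rw [Nat.sub_sub_self (by omega)] at this
    exact (mul_self_le_mul_self_iff (hP _) (hP _)).2 this
  exact ⟨LL_reflect_sum_eulerRefined hP hPP hp0, LL_symmDecomp_sum_eulerRefined hP hPP hPn hp0 hab,
    alternatinglyIncreasing_sum_eulerRefined hP hPn⟩
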